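/- Notation. For $0<q<1$ let $(x;q)_n=\prod_{i=0}^{n-1}(1-xq^i)$, $(x;q)_\infty=\prod_{i\ge 0}(1-xq^i)$, $(x_1,\dots,x_m;q)_n=\prod_j (x_j;q)_n$, and, for complex $x$, $$\Gamma_q(x)=(1-q)^{1-x}\frac{(q;q)_\infty}{(q^x;q)_\infty}.$$ Write $(x)_n=x(x+1)\cdots(x+n-1)$. (1) For every $0<q<1$ all series below converge and $$\frac{(1-q^2)^4}{(1-q)^2\,\Gamma_{q^2}(1/2)^6}\sum_{k\ge 0}(-1)^k q^{3k(k+1)}\,\frac{1+q^{1+2k}}{1+q}\,\frac{1-q}{1-q^{1+2k}}=\sum_{n\ge 0}T_n(q),$$ where $$T_n(q)=\frac{q^{2n}\,p_n(q)\,(q^2;q^2)_{3n}\,(q;q^2)_n^6}{(q^{2n}+q^{4n}+1)(q^{2n+1}+1)^3(q^2;q^2)_n^3(q^2;q^2)_{2n}^3},$$ $$p_n(q)=3q^{2n+1}-4q^{4n+1}+2q^{4n+2}-4q^{6n+1}-4q^{6n+2}+2q^{8n+1}-4q^{8n+2}+3q^{10n+2}+3q^{12n+3}+3 .$$ (2)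 This is a $q$-analogue of Guillera's formula $$\sum_{n\ge 0}\Big(\frac{3^3}{4^3}\Big)^n\frac{(\frac12)_n^3(\frac13)_n(\frac23)_n}{(1)_n^5}(74n^2+27n+3)=\frac{48}{\pi^2}$$ in the following sense: as $q\to 1^-$, for each $n$, $$\frac{T_n(q)}{(1-q)^2}\to \frac1{12}\Big(\frac{3^3}{4^3}\Big)^n\frac{(\frac12)_n^3(\frac13)_n(\frac23)_n}{(1)_n^5}(74n^2+27n+3),$$ and the left-hand side of (1) divided by $(1-q)^2$ tends to $\frac1{12}\cdot\frac{48}{\pi^2}$. (3) Let $$\mathsf{Dougall5F4}_q(a,b,c,d,k)=\frac{q^{k(a-b-c-d+1)}(1-q^{a+2k})\Gamma_q(a+k)\Gamma_q(b+k)\Gamma_q(c+k)\Gamma_q(d+k)\Gamma_q(a-b-c+1)\Gamma_q(a-b-d+1)\Gamma_q(a-c-d+1)}{(1-q)\Gamma_q(b)\Gamma_q(c)\Gamma_q(d)\Gamma_q(k+1)\Gamma_q(a-b+k+1)\Gamma_q(a-c+k+1)\Gamma_q(a-d+k+1)\Gamma_q(a-b-c-d+1)}$$ and $F(n,k)=\mathsf{Dougall5F4}_q(\tfrac12-n,\tfrac12-n,\tfrac12-n,n,2n+k)$.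 Let $0<q<1$ and let $a\in\mathbb C$ be such that neither $q^{2a}$ nor $q^{3a}$ is an integer power of $q$ (in particular this holds for all $a\neq 0$ close enough to $0$). Then $\sum_{k\ge0}F(n+a,k)$ converges for every integer $n\ge 0$, and the limit $L(a)=\lim_{n\to\infty}\sum_{k\ge 0}F(n+a,k)$ exists, is nonzero, and equals $$L(a)=\frac{q^a\,\Gamma_q(1-a)^2\,\Gamma_q(a)^2}{\Gamma_q(\frac32)^2\,\Gamma_q(\frac12-a)^2\,\Gamma_q(a+\frac12)^2}\sum_{k\ge 0}(-1)^kq^{3k(k+1)/2}\,\frac{1+q^{1/2+k}}{1+q^{1/2}}\,\frac{1-q^{1/2}}{1-q^{1/2+k}} .$$ (4) Under the same assumptions on $q$ and $a$, put $$A=\frac{q^a(1-q^a)\,\Gamma_q(1-a)^2\,\Gamma_q(a+\frac12)^4\,\Gamma_q(3a+1)}{\Gamma_q(\frac12)^2\,\Gamma_q(\frac12-a)^2\,\Gamma_q(a+1)\,\Gamma_q(2a+1)^3}.$$ Then $A\neq 0$, the series below converge, and $$\sum_{k\ge 0}\frac{q^{k/2}(1-q^{3a+2k+\frac12})(q^{3a+1};q)_k(q^{a+\frac12};q)_k^3}{(1-q^{k+\frac12})(1-q^{3a+k})(q^{1/2};q)_k(q^{2a+1};q)_k^3}=\sum_{n\ge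 0}\frac{q^{a+n}P_q(n)(q^{3a+1};q)_{3n}(q^{a+\frac12};q)_n^6}{(1-q^a)^3(q^{a+n}+q^{2a+2n}+1)(1-q^{2a+2n+1})^3(q^{a+1};q)_n^3(q^{2a+1};q)_{2n}^3}+\frac{L(a)}{A},$$ where, with $x=q^{a+n}$, $$\begin{aligned}P_q(n)={}&6xq^{1/2}-2x^2q+4x^2q^{1/2}-8x^3q+4x^3q^{1/2}-8x^4q-3x^4q^2-2x^4q^{1/2}+3x^5q+8x^5q^2+2x^5q^{5/2}\\&+8x^6q^2-4x^6q^{5/2}+2x^7q^2-4x^7q^{5/2}-6x^8q^{5/2}+3x^9q^3-3.\end{aligned}$$ -/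

import Mathlib

open Filter Topology

noncomputable section

/-- The finite `q`-shifted factorial `(a; q)_n = ∏_{i < n} (1 - a q^i)`. -/
def qPoch (a q : ℂ) (n : ℕ) : ℂ := ∏ i ∈ Finset.range n, (1 - a * q ^ i)

/-- The infinite `q`-shifted factorial `(a; q)_∞ = ∏_{i ≥ 0} (1 - a q^i)`, for `|q| < 1`. -/
def qPochInf (a q : ℂ) : ℂ := ∏' i : ℕ, (1 - a * q ^ i)

/-- The `q`-gamma function
`Γ_q(x) = (1 - q)^(1 - x) (q; q)_∞ / (q^x; q)_∞`, for `0 < q < 1` and complex `x`. -/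
def qGamma (q : ℝ) (x : ℂ) : ℂ :=
  (1 - (q : ℂ)) ^ (1 - x) * qPochInf q q / qPochInf ((q : ℂ) ^ x) q

/-- The classical rising factorial `(x)_n = x (x + 1) ⋯ (x + n - 1)`. -/
def rising (x : ℂ) (n : ℕ) : ℂ := ∏ i ∈ Finset.range n, (x + i)

/-- The summand of Guillera's series
`∑ (27/64)^n (1/2)_n^3 (1/3)_n (2/3)_n / (1)_n^5 * (74 n^2 + 27 n + 3)`. -/
def guilleraTerm (n : ℕ) : ℂ :=
  ((3 : ℂ) ^ 3 / 4 ^ 3) ^ n * (rising (1 / 2) n ^ 3 * rising (1 / 3) n * rising (2 / 3) n) /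
    rising 1 n ^ 5 * (74 * (n : ℂ) ^ 2 + 27 * n + 3)

/-- The summand of the explicit `q`-series. -/
def qGuilleraTerm (q : ℂ) (n : ℕ) : ℂ :=
  q ^ (2 * n) *
      (3 * q ^ (2 * n + 1) - 4 * q ^ (4 * n + 1) + 2 * q ^ (4 * n + 2) - 4 * q ^ (6 * n + 1)
        - 4 * q ^ (6 * n + 2) + 2 * q ^ (8 * n + 1) - 4 * q ^ (8 * n + 2)
        + 3 * q ^ (10 * n + 2) + 3 * q ^ (12 * n + 3) + 3) *
      qPoch (q ^ 2) (q ^ 2) (3 * n) * qPoch q (q ^ 2) n ^ 6 /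
    ((q ^ (2 * n) + q ^ (4 * n) + 1) * (q ^ (2 * n + 1) + 1) ^ 3 *
      qPoch (q ^ 2) (q ^ 2) n ^ 3 * qPoch (q ^ 2) (q ^ 2) (2 * n) ^ 3)

/-- `(-1)^k p^(3k(k+1)) (1 + p^(1+2k)) / (1 + p) * (1 - p) / (1 - p^(1+2k))`. -/
def altTerm (p : ℂ) (k : ℕ) : ℂ :=
  (-1) ^ k * p ^ (3 * k * (k + 1)) * ((1 + p ^ (1 + 2 * k)) / (1 + p)) *
    ((1 - p) / (1 - p ^ (1 + 2 * k)))

/-- The `q`-gamma factor times the alternating series: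
`(1 - q^2)^4 / ((1 - q)^2 Γ_{q^2}(1/2)^6) * ∑_k altTerm q k`. -/
def qGuilleraValue (q : ℝ) : ℂ :=
  (1 - (q : ℂ) ^ 2) ^ 4 / ((1 - (q : ℂ)) ^ 2 * qGamma (q ^ 2) (1 / 2) ^ 6) *
    ∑' k : ℕ, altTerm q k

/-- The term `Dougall5F4_q(a, b, c, d, k)`; here `k` is a complex variable. -/
def dougall5F4q (q : ℝ) (a b c d k : ℂ) : ℂ :=
  (q : ℂ) ^ (k * (a - b - c - d + 1)) * (1 - (q : ℂ) ^ (a + 2 * k)) *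
      qGamma q (a + k) * qGamma q (b + k) * qGamma q (c + k) * qGamma q (d + k) *
      qGamma q (a - b - c + 1) * qGamma q (a - b - d + 1) * qGamma q (a - c - d + 1) /
    ((1 - (q : ℂ)) * qGamma q b * qGamma q c * qGamma q d * qGamma q (k + 1) *
      qGamma q (a - b + k + 1) * qGamma q (a - c + k + 1) * qGamma q (a - d + k + 1) *
      qGamma q (a - b - c - d + 1))

/-- `F(n, k) = Dougall5F4_q(1/2 - n, 1/2 - n, 1/2 - n, n, 2n + k)`, with `n` a complex variable. -/
def wzF (q : ℝ) (n : ℂ) (k : ℕ) : ℂ :=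
  dougall5F4q q (1 / 2 - n) (1 / 2 - n) (1 / 2 - n) n (2 * n + k)

/-- The value of the boundary limit. The series is
`∑_k (-1)^k q^(3k(k+1)/2) (1 + q^(1/2+k)) / (1 + q^(1/2)) * (1 - q^(1/2)) / (1 - q^(1/2+k))`,
which is the series of `altTerm p k` at `p = q^(1/2)`. -/
def boundaryValue (q : ℝ) (a : ℂ) : ℂ :=
  (q : ℂ) ^ a * qGamma q (1 - a) ^ 2 * qGamma q a ^ 2 /
      (qGamma q (3 / 2) ^ 2 * qGamma q (1 / 2 - a) ^ 2 * qGamma q (a + 1 / 2) ^ 2) *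
    ∑' k : ℕ, altTerm ((q : ℂ) ^ (1 / 2 : ℂ)) k

/-- The factor `A`. -/
def factorA (q : ℝ) (a : ℂ) : ℂ :=
  (q : ℂ) ^ a * (1 - (q : ℂ) ^ a) * qGamma q (1 - a) ^ 2 * qGamma q (a + 1 / 2) ^ 4 *
      qGamma q (3 * a + 1) /
    (qGamma q (1 / 2) ^ 2 * qGamma q (1 / 2 - a) ^ 2 * qGamma q (a + 1) *
      qGamma q (2 * a + 1) ^ 3)

/-- The summand of the `k`-series in the identity with the parameter `a`. -/
def kTerm (q : ℝ) (a : ℂ) (k : ℕ) : ℂ :=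
  (q : ℂ) ^ ((k : ℂ) / 2) * (1 - (q : ℂ) ^ (3 * a + 2 * k + 1 / 2)) *
      qPoch ((q : ℂ) ^ (3 * a + 1)) q k * qPoch ((q : ℂ) ^ (a + 1 / 2)) q k ^ 3 /
    ((1 - (q : ℂ) ^ ((k : ℂ) + 1 / 2)) * (1 - (q : ℂ) ^ (3 * a + k)) *
      qPoch ((q : ℂ) ^ (1 / 2 : ℂ)) q k * qPoch ((q : ℂ) ^ (2 * a + 1)) q k ^ 3)

/-- The polynomial `P_q(n)` of the identity with the parameter `a`,
written in `x = q^(a+n)` and `s = q^(1/2)`. -/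
def polyP (q s x : ℂ) : ℂ :=
  6 * x * s - 2 * x ^ 2 * q + 4 * x ^ 2 * s - 8 * x ^ 3 * q + 4 * x ^ 3 * s
    - 8 * x ^ 4 * q - 3 * x ^ 4 * q ^ 2 - 2 * x ^ 4 * s + 3 * x ^ 5 * q + 8 * x ^ 5 * q ^ 2
    + 2 * x ^ 5 * (q ^ 2 * s) + 8 * x ^ 6 * q ^ 2 - 4 * x ^ 6 * (q ^ 2 * s) + 2 * x ^ 7 * q ^ 2
    - 4 * x ^ 7 * (q ^ 2 * s) - 6 * x ^ 8 * (q ^ 2 * s) + 3 * x ^ 9 * q ^ 3 - 3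

/-- The summand of the `n`-series in the identity with the parameter `a`. -/
def nTerm (q : ℝ) (a : ℂ) (n : ℕ) : ℂ :=
  (q : ℂ) ^ (a + n) * polyP q ((q : ℂ) ^ (1 / 2 : ℂ)) ((q : ℂ) ^ (a + n)) *
      qPoch ((q : ℂ) ^ (3 * a + 1)) q (3 * n) * qPoch ((q : ℂ) ^ (a + 1 / 2)) q n ^ 6 /
    ((1 - (q : ℂ) ^ a) ^ 3 * ((q : ℂ) ^ (a + n) + (q : ℂ) ^ (2 * a + 2 * n) + 1) *
      (1 - (q : ℂ) ^ (2 * a + 2 * n + 1)) ^ 3 * qPoch ((q : ℂ) ^ (a + 1)) q n ^ 3 *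
      qPoch ((q : ℂ) ^ (2 * a + 1)) q (2 * n) ^ 3)

end

open Filter Topology

noncomputable section

/-! The engine is a WZ pair. With `s = q^(1/2)` and `x = q^a`, the Dougall term `F(n + a, k)` equals
`factorA` times `wzPhi s x n k / (1 - x)^3`. A rational certificate, with numerator `certPoly`,
gives `Φ(n+1, k) - Φ(n, k) = G(n, k+1) - G(n, k)`. Since `G(n, k) → 0` as `k → ∞`, summing over `k`
yields `∑ Φ(n+1, ·) - ∑ Φ(n, ·) = -G(n, 0)`, and summing over `n` yields `∑ G(n, 0) = ∑ Φ(0, ·) -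
lim ∑ Φ(n, ·)` (`WZParam.hasSum_G0`). This is the identity with the parameter `a`.

Dominated convergence evaluates the limit as an infinite product times `∑ s^k / (s; q)_{k+1}`. That
series becomes the alternating one in three moves. A Rogers-Fine recurrence turns it into `∑
q^(n²+n) / (s; q)_{n+1}²`. A Bailey pair expands `1 / (s; q)_{n+1}²` in the sequence `baileyAlpha`.
After the double sum is rearranged, Cauchy's sum replaces each inner series by `1 / (q; q)_∞`
(`tsum_pow_div_qPoch`).

The pair is normalised by `(1 - x)^3` so that it survives at `x = 1`. There `Φ(0, ·)` vanishes
identically, and taking `s` to be the `q` of the first identity (so that the base is `q²`) leaves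
exactly the `q`-analogue of Guillera's series.

For `q → 1⁻`, each summand is a product of ratios `(1 - q^m) / (1 - q)`, apart from a polynomial
with a double zero. On the other side the alternating series tends to Leibniz's `π/4`, and a
`q`-Wallis product gives `Γ_{q²}(1/2)² → π`. -/

/-! ### Finite and infinite `q`-shifted factorials -/

theorem qPoch_zero (a q : ℂ) : qPoch a q 0 = 1 := by simp [qPoch]

theorem qPoch_succ (a q : ℂ) (n : ℕ) : qPoch a q (n + 1) = qPoch a q n * (1 - a * q ^ n) := by
  simp [qPoch, Finset.prod_range_succ]

theorem qPoch_add (a q : ℂ) (m n : ℕ) :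
    qPoch a q (m + n) = qPoch a q m * qPoch (a * q ^ m) q n := by
  simp [qPoch, Finset.prod_range_add, pow_add, mul_assoc]

theorem qPoch_succ' (a q : ℂ) (n : ℕ) :
    qPoch a q (n + 1) = (1 - a) * qPoch (a * q) q n := by
  have := qPoch_add a q 1 n
  rw [add_comm n 1, this]
  simp [qPoch]

theorem qPoch_ne_zero {a q : ℂ} (h : ∀ i : ℕ, 1 - a * q ^ i ≠ 0) (n : ℕ) : qPoch a q n ≠ 0 :=
  Finset.prod_ne_zero_iff.2 fun i _ => h i

theorem summable_norm_neg_mul_pow (a : ℂ) {q : ℂ} (hq : ‖q‖ < 1) :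
    Summable fun i : ℕ => ‖-(a * q ^ i)‖ := by
  simpa using (summable_geometric_of_lt_one (norm_nonneg q) hq).mul_left ‖a‖

theorem multipliable_one_sub_mul_pow (a : ℂ) {q : ℂ} (hq : ‖q‖ < 1) :
    Multipliable fun i : ℕ => 1 - a * q ^ i := by
  simpa [sub_eq_add_neg] using multipliable_one_add_of_summable (summable_norm_neg_mul_pow a hq)

theorem tendsto_qPoch (a : ℂ) {q : ℂ} (hq : ‖q‖ < 1) :
    Tendsto (qPoch a q) atTop (𝓝 (qPochInf a q)) :=
  (multipliable_one_sub_mul_pow a hq).hasProd.tendsto_prod_nat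

theorem qPochInf_ne_zero {a q : ℂ} (hq : ‖q‖ < 1) (h : ∀ i : ℕ, 1 - a * q ^ i ≠ 0) :
    qPochInf a q ≠ 0 := by
  have := tprod_one_add_ne_zero_of_summable (f := fun i : ℕ => -(a * q ^ i))
    (fun i => by simpa [sub_eq_add_neg] using h i) (summable_norm_neg_mul_pow a hq)
  simpa [qPochInf, sub_eq_add_neg] using this

theorem qPochInf_eq_mul (a : ℂ) {q : ℂ} (hq : ‖q‖ < 1) (n : ℕ) :
    qPochInf a q = qPoch a q n * qPochInf (a * q ^ n) q := by
  have h1 : Tendsto (fun m => qPoch a q (m + n)) atTop (𝓝 (qPochInf a q)) :=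
    (tendsto_add_atTop_iff_nat n).2 (tendsto_qPoch a hq)
  have h2 : Tendsto (fun m => qPoch a q (m + n)) atTop
      (𝓝 (qPoch a q n * qPochInf (a * q ^ n) q)) := by
    simp_rw [add_comm _ n, qPoch_add]
    exact (tendsto_qPoch _ hq).const_mul _
  exact tendsto_nhds_unique h1 h2

theorem exists_norm_le_of_tendsto {u : ℕ → ℂ} {l : ℂ} (h : Tendsto u atTop (𝓝 l)) :
    ∃ C : ℝ, 0 ≤ C ∧ ∀ n, ‖u n‖ ≤ C := by
  obtain ⟨C, hC⟩ := (Metric.isBounded_range_of_tendsto u h).exists_norm_le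
  have hC' : ∀ n, ‖u n‖ ≤ C := fun n => hC _ ⟨n, rfl⟩
  exact ⟨C, (norm_nonneg _).trans (hC' 0), hC'⟩

theorem tendsto_qPoch_inv {a q : ℂ} (hq : ‖q‖ < 1) (h : ∀ i : ℕ, 1 - a * q ^ i ≠ 0) :
    Tendsto (fun n => (qPoch a q n)⁻¹) atTop (𝓝 (qPochInf a q)⁻¹) :=
  (tendsto_qPoch a hq).inv₀ (qPochInf_ne_zero hq h)

theorem tendsto_one_sub_mul_pow (a : ℂ) {q : ℂ} (hq : ‖q‖ < 1) :
    Tendsto (fun n : ℕ => 1 - a * q ^ n) atTop (𝓝 1) := by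
  simpa using ((tendsto_pow_atTop_nhds_zero_of_norm_lt_one hq).const_mul a).const_sub 1

theorem one_sub_ne_zero_of_norm_lt_one {z : ℂ} (hz : ‖z‖ < 1) : 1 - z ≠ 0 := by
  intro h
  rw [← sub_eq_zero.1 h] at hz
  simp at hz

theorem one_sub_mul_pow_ne_zero {a q : ℂ} (ha : ‖a‖ < 1) (hq : ‖q‖ < 1) (i : ℕ) :
    1 - a * q ^ i ≠ 0 := by
  refine one_sub_ne_zero_of_norm_lt_one ?_
  rw [norm_mul, norm_pow]
  exact mul_lt_one_of_nonneg_of_lt_one_left (norm_nonneg _) ha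
    (pow_le_one₀ (norm_nonneg _) hq.le)

/-! ### The WZ pair and its certificate -/

/-- The polynomial in the numerator of the WZ certificate. -/
def certPoly (s y t : ℂ) : ℂ :=
    (-3 * y + 3 * y ^ 2 + 3 * y ^ 2 * s - y ^ 3 - y ^ 3 * s - y ^ 3 * s ^ 2) +
    (3 * y ^ 2 * s + y ^ 3 - y ^ 3 * s - 6 * y ^ 4 * s ^ 2 - 3 * y ^ 5 * s + 3 * y ^ 5 * s ^ 2
      + y ^ 6 * s + y ^ 6 * s ^ 2 + y ^ 6 * s ^ 4) * t +
    (-y ^ 3 * s ^ 2 - 3 * y ^ 5 * s - 3 * y ^ 5 * s ^ 2 - 3 * y ^ 5 * s ^ 4 + y ^ 6 * s + 9 *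
      y ^ 6 * s ^ 2 + 9 * y ^ 6 * s ^ 4 + y ^ 6 * s ^ 5 - 3 * y ^ 7 * s ^ 2 - 3 * y ^ 7 * s ^
      4 - 3 * y ^ 7 * s ^ 5 - y ^ 9 * s ^ 4) * t ^ 2 +
    (y ^ 6 * s ^ 2 + y ^ 6 * s ^ 4 + y ^ 6 * s ^ 5 + 3 * y ^ 7 * s ^ 4 - 3 * y ^ 7 * s ^ 5 - 6
      * y ^ 8 * s ^ 4 - y ^ 9 * s ^ 5 + y ^ 9 * s ^ 6 + 3 * y ^ 10 * s ^ 5) * t ^ 3 +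
    (-y ^ 9 * s ^ 4 - y ^ 9 * s ^ 5 - y ^ 9 * s ^ 6 + 3 * y ^ 10 * s ^ 5 + 3 * y ^ 10 * s ^ 6
      - 3 * y ^ 11 * s ^ 6) * t ^ 4

/-- The hypergeometric factor common to both members of the WZ pair, in base `q = s ^ 2`. -/
def wzBase (s x : ℂ) (n k : ℕ) : ℂ :=
  s ^ k * qPoch (x * s) (s ^ 2) (n + k) ^ 3 * qPoch (x * s) (s ^ 2) n ^ 3 *
      qPoch (x ^ 3 * s ^ 2) (s ^ 2) (3 * n + k) /
    (qPoch (x * s ^ 2) (s ^ 2) n ^ 3 * qPoch (x ^ 2 * s ^ 2) (s ^ 2) (2 * n + k) ^ 3 *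
      qPoch s (s ^ 2) (k + 1))

/-- The first member of the WZ pair, normalised so that it makes sense at `x = 1`. -/
def wzPhi (s x : ℂ) (n k : ℕ) : ℂ :=
  wzBase s x n k * ((1 - s * x ^ 3 * (s ^ 2) ^ (3 * n + 2 * k)) * (1 - x * (s ^ 2) ^ n) ^ 3 /
    (1 - x ^ 3 * (s ^ 2) ^ (3 * n + k)))

/-- The second member of the WZ pair at `(n, k + 1)`. -/
def wzH (s x : ℂ) (n k : ℕ) : ℂ :=
  wzBase s x n k * (s * certPoly s (x * (s ^ 2) ^ n) ((s ^ 2) ^ (k + 1)) *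
    (1 - x * s * (s ^ 2) ^ (n + k)) ^ 3 /
      ((1 - x ^ 2 * s ^ 2 * (s ^ 2) ^ (2 * n + k)) ^ 3 *
        (1 - x ^ 2 * s ^ 2 * (s ^ 2) ^ (2 * n + k + 1)) ^ 3))

/-- The second member of the WZ pair at `(n, 0)`. -/
def wzG0 (s x : ℂ) (n : ℕ) : ℂ :=
  wzBase s x n 0 * ((1 - s) * (x * (s ^ 2) ^ n * polyP (s ^ 2) s (x * (s ^ 2) ^ n)) /
    ((1 - x ^ 2 * s ^ 2 * (s ^ 2) ^ (2 * n)) ^ 3 *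
      (1 + x * (s ^ 2) ^ n + (x * (s ^ 2) ^ n) ^ 2)))

/-- The WZ equation at `(n, k + 1)`, divided by `wzBase s x n (k + 1)` and cleared of denominators,
with `y = x q^n`, `t = q^(k+1)` and `q = s^2`. It is a polynomial identity in independent variables.
-/
theorem certPoly_identity (s y t : ℂ) :
    (1 - s * y ^ 3 * s ^ 6 * t ^ 2) * (1 - y * s * t) ^ 3 * (1 - y * s) ^ 3 *
        (1 - y ^ 3 * t * s ^ 2) * (1 - y ^ 3 * t * s ^ 4) * (1 - y ^ 3 * t) -
      (1 - s * y ^ 3 * t ^ 2) * (1 - y) ^ 3 *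
        ((1 - y ^ 2 * t * s ^ 2) ^ 3 * (1 - y ^ 2 * t * s ^ 4) ^ 3) =
    s * certPoly s y (t * s ^ 2) * (1 - y * s * t) ^ 3 * (1 - y ^ 3 * t) -
      (1 - s * t) * certPoly s y t * (1 - y ^ 2 * t * s ^ 4) ^ 3 := by
  unfold certPoly
  ring

/-- The factors occurring in the denominators of the WZ pair do not vanish. -/
structure WZParam (s x : ℂ) : Prop where
  s_ne : s ≠ 0
  s_lt : ‖s‖ < 1
  sq_ne : ∀ i : ℕ, 1 - x ^ 2 * s ^ 2 * (s ^ 2) ^ i ≠ 0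
  cube_ne : ∀ i : ℕ, 1 - x ^ 3 * s ^ 2 * (s ^ 2) ^ i ≠ 0
  quad_ne : 1 + x + x ^ 2 ≠ 0

namespace WZParam

variable {s x : ℂ}

theorem sq_lt (h : WZParam s x) : ‖s ^ 2‖ < 1 := by
  rw [norm_pow]
  exact pow_lt_one₀ (norm_nonneg _) h.s_lt two_ne_zero

theorem s_pow_ne (h : WZParam s x) (i : ℕ) : 1 - s * (s ^ 2) ^ i ≠ 0 := one_sub_mul_pow_ne_zero h.s_lt h.sq_lt i

theorem x_ne (h : WZParam s x) (i : ℕ) : 1 - x * s ^ 2 * (s ^ 2) ^ i ≠ 0 := by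
  intro h0
  refine h.sq_ne (2 * i + 1) ?_
  have : x * s ^ 2 * (s ^ 2) ^ i = 1 := (sub_eq_zero.1 h0).symm
  have h2 : x ^ 2 * s ^ 2 * (s ^ 2) ^ (2 * i + 1) = (x * s ^ 2 * (s ^ 2) ^ i) ^ 2 := by ring
  rw [h2, this]
  norm_num

/-- For `n ≥ 1` the factor divides `1 - (x q^n)^3`, which `cube_ne` covers. The case `n = 0` needs
its own hypothesis: `cube_ne` starts at `x^3 q`, so that `x = 1` remains admissible. -/
theorem quad_pow_ne (h : WZParam s x) (n : ℕ) : 1 + x * (s ^ 2) ^ n + (x * (s ^ 2) ^ n) ^ 2 ≠ 0 := by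
  rcases n with _ | n
  · simpa using h.quad_ne
  · intro h0
    refine h.cube_ne (3 * n + 2) ?_
    linear_combination (1 - x * (s ^ 2) ^ (n + 1)) * h0

theorem base_succ_right (h : WZParam s x) (n k : ℕ) :
    wzBase s x n (k + 1) = wzBase s x n k * (s * (1 - x * s * (s ^ 2) ^ (n + k)) ^ 3 *
      (1 - x ^ 3 * s ^ 2 * (s ^ 2) ^ (3 * n + k)) /
        ((1 - x ^ 2 * s ^ 2 * (s ^ 2) ^ (2 * n + k)) ^ 3 * (1 - s * (s ^ 2) ^ (k + 1)))) := by
  have h1 := h.sq_ne (2 * n + k)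
  have h2 := h.s_pow_ne (k + 1)
  have h3 := qPoch_ne_zero h.x_ne n
  have h4 := qPoch_ne_zero h.sq_ne (2 * n + k)
  have h5 := qPoch_ne_zero h.s_pow_ne (k + 1)
  unfold wzBase
  rw [← add_assoc, ← add_assoc, ← add_assoc, qPoch_succ _ _ (n + k), qPoch_succ _ _ (3 * n + k),
    qPoch_succ _ _ (2 * n + k), qPoch_succ _ _ (k + 1)]
  generalize 1 - x ^ 2 * s ^ 2 * (s ^ 2) ^ (2 * n + k) = A at *
  generalize 1 - s * (s ^ 2) ^ (k + 1) = B at *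
  generalize 1 - x ^ 3 * s ^ 2 * (s ^ 2) ^ (3 * n + k) = C at *
  generalize 1 - x * s * (s ^ 2) ^ (n + k) = D at *
  field_simp
  ring

theorem base_succ_left (h : WZParam s x) (n k : ℕ) :
    wzBase s x (n + 1) k = wzBase s x n k * ((1 - x * s * (s ^ 2) ^ (n + k)) ^ 3 *
      (1 - x * s * (s ^ 2) ^ n) ^ 3 *
      ((1 - x ^ 3 * s ^ 2 * (s ^ 2) ^ (3 * n + k)) *
        (1 - x ^ 3 * s ^ 2 * (s ^ 2) ^ (3 * n + k + 1)) *
        (1 - x ^ 3 * s ^ 2 * (s ^ 2) ^ (3 * n + k + 2))) /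
      ((1 - x * s ^ 2 * (s ^ 2) ^ n) ^ 3 * (1 - x ^ 2 * s ^ 2 * (s ^ 2) ^ (2 * n + k)) ^ 3 *
        (1 - x ^ 2 * s ^ 2 * (s ^ 2) ^ (2 * n + k + 1)) ^ 3)) := by
  have h1 := h.sq_ne (2 * n + k)
  have h2 := h.sq_ne (2 * n + k + 1)
  have h3 := qPoch_ne_zero h.x_ne n
  have h4 := qPoch_ne_zero h.sq_ne (2 * n + k)
  have h5 := qPoch_ne_zero h.s_pow_ne (k + 1)
  have h6 := h.x_ne n
  unfold wzBase
  rw [show n + 1 + k = n + k + 1 by ring, show 3 * (n + 1) + k = 3 * n + k + 1 + 1 + 1 by ring,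
    show 2 * (n + 1) + k = 2 * n + k + 1 + 1 by ring,
    qPoch_succ _ _ (n + k), qPoch_succ _ _ n, qPoch_succ _ _ n, qPoch_succ _ _ (3 * n + k + 1 + 1),
    qPoch_succ _ _ (3 * n + k + 1), qPoch_succ _ _ (3 * n + k),
    qPoch_succ _ _ (2 * n + k + 1), qPoch_succ _ _ (2 * n + k)]
  rw [show 3 * n + k + 1 + 1 = 3 * n + k + 2 by ring]
  generalize 1 - x ^ 2 * s ^ 2 * (s ^ 2) ^ (2 * n + k) = A at *
  generalize 1 - x ^ 2 * s ^ 2 * (s ^ 2) ^ (2 * n + k + 1) = B at *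
  generalize 1 - x ^ 3 * s ^ 2 * (s ^ 2) ^ (3 * n + k) = C at *
  generalize 1 - x ^ 3 * s ^ 2 * (s ^ 2) ^ (3 * n + k + 1) = C1 at *
  generalize 1 - x ^ 3 * s ^ 2 * (s ^ 2) ^ (3 * n + k + 2) = C2 at *
  generalize 1 - x * s * (s ^ 2) ^ (n + k) = D at *
  generalize 1 - x * s * (s ^ 2) ^ n = D1 at *
  generalize 1 - x * s ^ 2 * (s ^ 2) ^ n = E at *
  field_simp

theorem phi_succ_left (h : WZParam s x) (n k : ℕ) :
    wzPhi s x (n + 1) k = wzBase s x n k * ((1 - x * s * (s ^ 2) ^ (n + k)) ^ 3 *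
      (1 - x * s * (s ^ 2) ^ n) ^ 3 * (1 - s * x ^ 3 * (s ^ 2) ^ (3 * n + 2 * k + 3)) *
      ((1 - x ^ 3 * s ^ 2 * (s ^ 2) ^ (3 * n + k)) *
        (1 - x ^ 3 * s ^ 2 * (s ^ 2) ^ (3 * n + k + 1))) /
      ((1 - x ^ 2 * s ^ 2 * (s ^ 2) ^ (2 * n + k)) ^ 3 *
        (1 - x ^ 2 * s ^ 2 * (s ^ 2) ^ (2 * n + k + 1)) ^ 3)) := by
  have h1 := h.sq_ne (2 * n + k)
  have h2 := h.sq_ne (2 * n + k + 1)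
  have h3 := h.cube_ne (3 * n + k + 2)
  have h6 := h.x_ne n
  unfold wzPhi
  rw [h.base_succ_left,
    show x ^ 3 * (s ^ 2) ^ (3 * (n + 1) + k) = x ^ 3 * s ^ 2 * (s ^ 2) ^ (3 * n + k + 2) by ring,
    show x * (s ^ 2) ^ (n + 1) = x * s ^ 2 * (s ^ 2) ^ n by ring,
    show s * x ^ 3 * (s ^ 2) ^ (3 * (n + 1) + 2 * k) = s * x ^ 3 * (s ^ 2) ^ (3 * n + 2 * k + 3)
      by ring]
  generalize 1 - x ^ 2 * s ^ 2 * (s ^ 2) ^ (2 * n + k) = A at *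
  generalize 1 - x ^ 2 * s ^ 2 * (s ^ 2) ^ (2 * n + k + 1) = B at *
  generalize 1 - x ^ 3 * s ^ 2 * (s ^ 2) ^ (3 * n + k) = C at *
  generalize 1 - x ^ 3 * s ^ 2 * (s ^ 2) ^ (3 * n + k + 1) = C1 at *
  generalize 1 - x ^ 3 * s ^ 2 * (s ^ 2) ^ (3 * n + k + 2) = C2 at *
  generalize 1 - x * s * (s ^ 2) ^ (n + k) = D at *
  generalize 1 - x * s * (s ^ 2) ^ n = D1 at *
  generalize 1 - x * s ^ 2 * (s ^ 2) ^ n = E at *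
  field_simp

theorem wz_succ (h : WZParam s x) (n k : ℕ) :
    wzPhi s x (n + 1) (k + 1) - wzPhi s x n (k + 1) = wzH s x n (k + 1) - wzH s x n k := by
  have h1 := h.sq_ne (2 * n + (k + 1))
  have h2 := h.sq_ne (2 * n + (k + 1) + 1)
  have h3 := h.cube_ne (3 * n + k)
  have h4 := h.s_pow_ne (k + 1)
  have h5 := h.sq_ne (2 * n + k)
  -- All four terms must share the factor `wzBase s x n (k + 1)`. Moving `wzH s x n k` to it cancels
  -- the cubes `(1 - x s q^(n+k))^3` and `(1 - x^2 q^(2n+k+1))^3`.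
  have hH : wzH s x n k = wzBase s x n (k + 1) * ((1 - s * (s ^ 2) ^ (k + 1)) *
      certPoly s (x * (s ^ 2) ^ n) ((s ^ 2) ^ (k + 1)) /
      ((1 - x ^ 2 * s ^ 2 * (s ^ 2) ^ (2 * n + (k + 1))) ^ 3 *
        (1 - x ^ 3 * s ^ 2 * (s ^ 2) ^ (3 * n + k)))) := by
    rw [h.base_succ_right, wzH]
    rw [← add_assoc (2 * n) k 1] at *
    generalize 1 - x ^ 2 * s ^ 2 * (s ^ 2) ^ (2 * n + k) = A at *
    generalize 1 - x ^ 2 * s ^ 2 * (s ^ 2) ^ (2 * n + k + 1) = B at *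
    generalize 1 - x ^ 3 * s ^ 2 * (s ^ 2) ^ (3 * n + k) = C at *
    generalize 1 - s * (s ^ 2) ^ (k + 1) = D at *
    generalize 1 - x * s * (s ^ 2) ^ (n + k) = E at *
    field_simp
  rw [hH, h.phi_succ_left, wzPhi, wzH]
  have key := certPoly_identity s (x * (s ^ 2) ^ n) ((s ^ 2) ^ (k + 1))
  rw [show x ^ 3 * (s ^ 2) ^ (3 * n + (k + 1)) = x ^ 3 * s ^ 2 * (s ^ 2) ^ (3 * n + k) by ring,
    show (s ^ 2) ^ (k + 1 + 1) = (s ^ 2) ^ (k + 1) * s ^ 2 by ring]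
  rw [show (1 : ℂ) - (x * (s ^ 2) ^ n) ^ 2 * (s ^ 2) ^ (k + 1) * s ^ 2 =
      1 - x ^ 2 * s ^ 2 * (s ^ 2) ^ (2 * n + (k + 1)) by ring,
    show (1 : ℂ) - (x * (s ^ 2) ^ n) ^ 2 * (s ^ 2) ^ (k + 1) * s ^ 4 =
      1 - x ^ 2 * s ^ 2 * (s ^ 2) ^ (2 * n + (k + 1) + 1) by ring,
    show (1 : ℂ) - (x * (s ^ 2) ^ n) ^ 3 * (s ^ 2) ^ (k + 1) =
      1 - x ^ 3 * s ^ 2 * (s ^ 2) ^ (3 * n + k) by ring,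
    show (1 : ℂ) - (x * (s ^ 2) ^ n) ^ 3 * (s ^ 2) ^ (k + 1) * s ^ 2 =
      1 - x ^ 3 * s ^ 2 * (s ^ 2) ^ (3 * n + (k + 1)) by ring,
    show (1 : ℂ) - (x * (s ^ 2) ^ n) ^ 3 * (s ^ 2) ^ (k + 1) * s ^ 4 =
      1 - x ^ 3 * s ^ 2 * (s ^ 2) ^ (3 * n + (k + 1) + 1) by ring,
    show (1 : ℂ) - x * (s ^ 2) ^ n * s * (s ^ 2) ^ (k + 1) =
      1 - x * s * (s ^ 2) ^ (n + (k + 1)) by ring,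
    show (1 : ℂ) - x * (s ^ 2) ^ n * s = 1 - x * s * (s ^ 2) ^ n by ring,
    show (1 : ℂ) - s * (x * (s ^ 2) ^ n) ^ 3 * s ^ 6 * ((s ^ 2) ^ (k + 1)) ^ 2 =
      1 - s * x ^ 3 * (s ^ 2) ^ (3 * n + 2 * (k + 1) + 3) by ring,
    show (1 : ℂ) - s * (x * (s ^ 2) ^ n) ^ 3 * ((s ^ 2) ^ (k + 1)) ^ 2 =
      1 - s * x ^ 3 * (s ^ 2) ^ (3 * n + 2 * (k + 1)) by ring] at key
  generalize 1 - x ^ 2 * s ^ 2 * (s ^ 2) ^ (2 * n + (k + 1)) = A at *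
  generalize 1 - x ^ 2 * s ^ 2 * (s ^ 2) ^ (2 * n + (k + 1) + 1) = B at *
  generalize 1 - x ^ 3 * s ^ 2 * (s ^ 2) ^ (3 * n + k) = C at *
  generalize 1 - x ^ 3 * s ^ 2 * (s ^ 2) ^ (3 * n + (k + 1)) = C1 at *
  generalize 1 - x ^ 3 * s ^ 2 * (s ^ 2) ^ (3 * n + (k + 1) + 1) = C2 at *
  generalize 1 - x * s * (s ^ 2) ^ (n + (k + 1)) = D at *
  generalize 1 - x * s * (s ^ 2) ^ n = D1 at *
  generalize 1 - s * x ^ 3 * (s ^ 2) ^ (3 * n + 2 * (k + 1) + 3) = E1 at *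
  generalize 1 - s * x ^ 3 * (s ^ 2) ^ (3 * n + 2 * (k + 1)) = E at *
  generalize 1 - s * (s ^ 2) ^ (k + 1) = F at *
  generalize 1 - x * (s ^ 2) ^ n = Y at *
  generalize certPoly s (x * (s ^ 2) ^ n) ((s ^ 2) ^ (k + 1) * s ^ 2) = N1 at *
  generalize certPoly s (x * (s ^ 2) ^ n) ((s ^ 2) ^ (k + 1)) = N0 at *
  rw [← mul_sub, ← mul_sub]
  congr 1
  field_simp
  linear_combination key

/-- The boundary case `k = 0` of the WZ equation. Here the denominator `1 - y^3` of the first member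
loses its factor `1 - y` against `(1 - y)^3`, so only `1 + y + y^2` remains and the identity is
usable at `y = 1`. -/
theorem polyP_identity (s y : ℂ) :
    (1 - s * y ^ 3 * s ^ 6) * (1 - y * s) ^ 3 * (1 - y * s) ^ 3 *
        (1 - y ^ 3 * s ^ 2) * (1 - y ^ 3 * s ^ 4) * (1 + y + y ^ 2) -
      (1 - s * y ^ 3) * (1 - y) ^ 2 * ((1 - y ^ 2 * s ^ 2) ^ 3 * (1 - y ^ 2 * s ^ 4) ^ 3) =
    s * certPoly s y (s ^ 2) * (1 - y * s) ^ 3 * (1 + y + y ^ 2) -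
      (1 - s) * (y * polyP (s ^ 2) s y) * (1 - y ^ 2 * s ^ 4) ^ 3 := by
  unfold certPoly polyP
  ring

theorem one_sub_cube_div (y : ℂ) (hy : 1 + y + y ^ 2 ≠ 0) :
    (1 - y) ^ 3 / (1 - y ^ 3) = (1 - y) ^ 2 / (1 + y + y ^ 2) := by
  -- At `y = 1` the left side is `0 / 0`, which is `0` by convention and agrees with the continuous
  -- value on the right.
  by_cases h1 : 1 - y = 0
  · simp [h1]
  · rw [show 1 - y ^ 3 = (1 - y) * (1 + y + y ^ 2) by ring]
    field_simp

theorem wz_zero (h : WZParam s x) (n : ℕ) :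
    wzPhi s x (n + 1) 0 - wzPhi s x n 0 = wzH s x n 0 - wzG0 s x n := by
  have h1 := h.sq_ne (2 * n)
  have h2 := h.sq_ne (2 * n + 1)
  have h3 := h.quad_pow_ne n
  have hΦ : wzPhi s x n 0 = wzBase s x n 0 * ((1 - s * x ^ 3 * (s ^ 2) ^ (3 * n)) *
      (1 - x * (s ^ 2) ^ n) ^ 2 / (1 + x * (s ^ 2) ^ n + (x * (s ^ 2) ^ n) ^ 2)) := by
    rw [wzPhi, mul_div_assoc, mul_div_assoc, ← one_sub_cube_div _ h3,
      show (x * (s ^ 2) ^ n) ^ 3 = x ^ 3 * (s ^ 2) ^ (3 * n + 0) by ring]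
    rfl
  rw [hΦ, h.phi_succ_left, wzH, wzG0]
  have key := polyP_identity s (x * (s ^ 2) ^ n)
  simp only [mul_zero, add_zero, zero_add, pow_one]
  rw [show (1 : ℂ) - (x * (s ^ 2) ^ n) ^ 2 * s ^ 2 =
      1 - x ^ 2 * s ^ 2 * (s ^ 2) ^ (2 * n) by ring,
    show (1 : ℂ) - (x * (s ^ 2) ^ n) ^ 2 * s ^ 4 =
      1 - x ^ 2 * s ^ 2 * (s ^ 2) ^ (2 * n + 1) by ring,
    show (1 : ℂ) - (x * (s ^ 2) ^ n) ^ 3 * s ^ 2 =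
      1 - x ^ 3 * s ^ 2 * (s ^ 2) ^ (3 * n) by ring,
    show (1 : ℂ) - (x * (s ^ 2) ^ n) ^ 3 * s ^ 4 =
      1 - x ^ 3 * s ^ 2 * (s ^ 2) ^ (3 * n + 1) by ring,
    show (1 : ℂ) - x * (s ^ 2) ^ n * s = 1 - x * s * (s ^ 2) ^ n by ring,
    show (1 : ℂ) - s * (x * (s ^ 2) ^ n) ^ 3 * s ^ 6 =
      1 - s * x ^ 3 * (s ^ 2) ^ (3 * n + 3) by ring,
    show (1 : ℂ) - s * (x * (s ^ 2) ^ n) ^ 3 =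
      1 - s * x ^ 3 * (s ^ 2) ^ (3 * n) by ring] at key
  generalize 1 - x ^ 2 * s ^ 2 * (s ^ 2) ^ (2 * n) = A at *
  generalize 1 - x ^ 2 * s ^ 2 * (s ^ 2) ^ (2 * n + 1) = B at *
  generalize 1 - x ^ 3 * s ^ 2 * (s ^ 2) ^ (3 * n) = C1 at *
  generalize 1 - x ^ 3 * s ^ 2 * (s ^ 2) ^ (3 * n + 1) = C2 at *
  generalize 1 - x * s * (s ^ 2) ^ n = D at *
  generalize 1 - s * x ^ 3 * (s ^ 2) ^ (3 * n + 3) = E1 at *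
  generalize 1 - s * x ^ 3 * (s ^ 2) ^ (3 * n) = E at *
  generalize polyP (s ^ 2) s (x * (s ^ 2) ^ n) = P at *
  generalize 1 + x * (s ^ 2) ^ n + (x * (s ^ 2) ^ n) ^ 2 = Q at *
  generalize 1 - x * (s ^ 2) ^ n = Y at *
  generalize certPoly s (x * (s ^ 2) ^ n) (s ^ 2) = N1 at *
  rw [← mul_sub, ← mul_sub]
  congr 1
  field_simp
  linear_combination key

theorem sum_range_wz (h : WZParam s x) (n K : ℕ) :
    ∑ k ∈ Finset.range (K + 1), (wzPhi s x (n + 1) k - wzPhi s x n k) =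
      wzH s x n K - wzG0 s x n := by
  induction K with
  | zero => simpa using h.wz_zero n
  | succ K ih =>
    rw [Finset.sum_range_succ, ih, h.wz_succ]
    ring

end WZParam

/-! ### Summation of the WZ pair -/

theorem tendsto_atTop_of_le {f : ℕ → ℕ} (h : ∀ n, n ≤ f n) : Tendsto f atTop atTop :=
  tendsto_atTop_mono h tendsto_id

namespace WZParam

variable {s x : ℂ}

theorem phi_eq (s x : ℂ) (n k : ℕ) :
    wzPhi s x n k = s ^ k * (qPoch (x * s) (s ^ 2) (n + k) ^ 3 * qPoch (x * s) (s ^ 2) n ^ 3 *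
      qPoch (x ^ 3 * s ^ 2) (s ^ 2) (3 * n + k) * (qPoch (x * s ^ 2) (s ^ 2) n)⁻¹ ^ 3 *
      (qPoch (x ^ 2 * s ^ 2) (s ^ 2) (2 * n + k))⁻¹ ^ 3 * (qPoch s (s ^ 2) (k + 1))⁻¹ *
      (1 - s * x ^ 3 * (s ^ 2) ^ (3 * n + 2 * k)) * (1 - x * (s ^ 2) ^ n) ^ 3 *
      (1 - x ^ 3 * (s ^ 2) ^ (3 * n + k))⁻¹) := by
  rw [wzPhi, wzBase]
  simp only [div_eq_mul_inv, mul_inv, inv_pow]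
  ring

theorem tendsto_inv_one_sub (h : WZParam s x) (a : ℂ) :
    Tendsto (fun m : ℕ => (1 - a * (s ^ 2) ^ m)⁻¹) atTop (𝓝 1) := by
  simpa using (tendsto_one_sub_mul_pow a h.sq_lt).inv₀ one_ne_zero

/-- Apart from `s^k`, every factor of `Φ` is a term of a convergent sequence, hence bounded
uniformly in `n` and `k`. The resulting majorant is independent of `n`, as dominated convergence
requires. -/
theorem exists_norm_phi_le (h : WZParam s x) :
    ∃ C : ℝ, ∀ n k, ‖wzPhi s x n k‖ ≤ C * ‖s‖ ^ k := by
  obtain ⟨C1, p1, h1⟩ := exists_norm_le_of_tendsto (tendsto_qPoch (x * s) h.sq_lt)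
  obtain ⟨C2, p2, h2⟩ := exists_norm_le_of_tendsto (tendsto_qPoch (x ^ 3 * s ^ 2) h.sq_lt)
  obtain ⟨C3, p3, h3⟩ := exists_norm_le_of_tendsto (tendsto_qPoch_inv h.sq_lt h.x_ne)
  obtain ⟨C4, p4, h4⟩ := exists_norm_le_of_tendsto (tendsto_qPoch_inv h.sq_lt h.sq_ne)
  obtain ⟨C5, p5, h5⟩ := exists_norm_le_of_tendsto (tendsto_qPoch_inv h.sq_lt h.s_pow_ne)
  obtain ⟨C6, p6, h6⟩ := exists_norm_le_of_tendsto (tendsto_one_sub_mul_pow (s * x ^ 3) h.sq_lt)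
  obtain ⟨C7, p7, h7⟩ := exists_norm_le_of_tendsto (tendsto_one_sub_mul_pow x h.sq_lt)
  obtain ⟨C8, p8, h8⟩ := exists_norm_le_of_tendsto (h.tendsto_inv_one_sub (x ^ 3))
  refine ⟨C1 ^ 3 * C1 ^ 3 * C2 * C3 ^ 3 * C4 ^ 3 * C5 * C6 * C7 ^ 3 * C8, fun n k => ?_⟩
  rw [phi_eq, norm_mul, norm_pow, mul_comm]
  refine mul_le_mul_of_nonneg_right ?_ (by positivity)
  have hp : ∀ {z : ℂ} {C : ℝ}, ‖z‖ ≤ C → ‖z ^ 3‖ ≤ C ^ 3 := fun hz => by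
    rw [norm_pow]
    exact pow_le_pow_left₀ (norm_nonneg _) hz 3
  exact norm_mul_le_of_le (norm_mul_le_of_le (norm_mul_le_of_le (norm_mul_le_of_le
    (norm_mul_le_of_le (norm_mul_le_of_le (norm_mul_le_of_le (norm_mul_le_of_le
      (hp (h1 _)) (hp (h1 _))) (h2 _)) (hp (h3 _))) (hp (h4 _))) (h5 _)) (h6 _)) (hp (h7 _))) (h8 _)

/-- The infinite product multiplying the limit of the sums of the first member of the WZ pair. -/
def _root_.wzConst (s x : ℂ) : ℂ :=
  qPochInf (x * s) (s ^ 2) ^ 6 * qPochInf (x ^ 3 * s ^ 2) (s ^ 2) /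
    (qPochInf (x * s ^ 2) (s ^ 2) ^ 3 * qPochInf (x ^ 2 * s ^ 2) (s ^ 2) ^ 3)

theorem tendsto_phi (h : WZParam s x) (k : ℕ) :
    Tendsto (fun n => wzPhi s x n k) atTop
      (𝓝 (wzConst s x * (s ^ k / qPoch s (s ^ 2) (k + 1)))) := by
  have e1 : Tendsto (fun n : ℕ => n + k) atTop atTop := tendsto_add_atTop_nat k
  have e2 : Tendsto (fun n : ℕ => 2 * n + k) atTop atTop :=
    tendsto_atTop_of_le fun _ => by lia
  have e3 : Tendsto (fun n : ℕ => 3 * n + k) atTop atTop :=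
    tendsto_atTop_of_le fun _ => by lia
  have e4 : Tendsto (fun n : ℕ => 3 * n + 2 * k) atTop atTop :=
    tendsto_atTop_of_le fun _ => by lia
  have hU := tendsto_qPoch (x * s) h.sq_lt
  have hW := tendsto_qPoch_inv h.sq_lt h.sq_ne
  have := ((((((((hU.comp e1).pow 3).mul (hU.pow 3)).mul
    ((tendsto_qPoch (x ^ 3 * s ^ 2) h.sq_lt).comp e3)).mul
    ((tendsto_qPoch_inv h.sq_lt h.x_ne).pow 3)).mul ((hW.comp e2).pow 3)).mul_const
    ((qPoch s (s ^ 2) (k + 1))⁻¹)).mul ((tendsto_one_sub_mul_pow (s * x ^ 3) h.sq_lt).comp e4)).mul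
    ((tendsto_one_sub_mul_pow x h.sq_lt).pow 3) |>.mul
    ((h.tendsto_inv_one_sub (x ^ 3)).comp e3) |>.const_mul (s ^ k)
  convert this.congr fun n => (phi_eq s x n k).symm using 2
  rw [wzConst]
  simp only [div_eq_mul_inv, mul_inv, inv_pow]
  ring

theorem summable_phi (h : WZParam s x) (n : ℕ) : Summable (wzPhi s x n) := by
  obtain ⟨C, hC⟩ := h.exists_norm_phi_le
  exact Summable.of_norm_bounded
    ((summable_geometric_of_lt_one (norm_nonneg s) h.s_lt).mul_left C) (hC n)

theorem tendsto_tsum_phi (h : WZParam s x) :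
    Tendsto (fun n => ∑' k, wzPhi s x n k) atTop
      (𝓝 (wzConst s x * ∑' k, s ^ k / qPoch s (s ^ 2) (k + 1))) := by
  obtain ⟨C, hC⟩ := h.exists_norm_phi_le
  rw [← tsum_mul_left]
  exact tendsto_tsum_of_dominated_convergence
    ((summable_geometric_of_lt_one (norm_nonneg s) h.s_lt).mul_left C) h.tendsto_phi
    (Eventually.of_forall hC)

theorem tendsto_base (h : WZParam s x) (n : ℕ) : Tendsto (wzBase s x n) atTop (𝓝 0) := by
  have e1 : Tendsto (fun k : ℕ => n + k) atTop atTop :=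
    tendsto_atTop_of_le fun _ => by lia
  have e2 : Tendsto (fun k : ℕ => 2 * n + k) atTop atTop :=
    tendsto_atTop_of_le fun _ => by lia
  have e3 : Tendsto (fun k : ℕ => 3 * n + k) atTop atTop :=
    tendsto_atTop_of_le fun _ => by lia
  have hU := tendsto_qPoch (x * s) h.sq_lt
  have hW := tendsto_qPoch_inv h.sq_lt h.sq_ne
  have hT := (tendsto_add_atTop_iff_nat 1).2 (tendsto_qPoch_inv h.sq_lt h.s_pow_ne)
  have := ((((tendsto_pow_atTop_nhds_zero_of_norm_lt_one h.s_lt).mul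
    ((hU.comp e1).pow 3)).mul_const (qPoch (x * s) (s ^ 2) n ^ 3)).mul
    ((tendsto_qPoch (x ^ 3 * s ^ 2) h.sq_lt).comp e3)).mul
    ((((hW.comp e2).pow 3).const_mul ((qPoch (x * s ^ 2) (s ^ 2) n)⁻¹ ^ 3)).mul hT)
  simp only [zero_mul] at this
  refine this.congr fun k => ?_
  rw [wzBase, div_eq_mul_inv, mul_inv, mul_inv, ← inv_pow, ← inv_pow]
  rfl

theorem tendsto_H (h : WZParam s x) (n : ℕ) : Tendsto (wzH s x n) atTop (𝓝 0) := by
  have e1 : Tendsto (fun k : ℕ => n + k) atTop atTop :=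
    tendsto_atTop_of_le fun _ => by lia
  have e2 : Tendsto (fun k : ℕ => 2 * n + k) atTop atTop :=
    tendsto_atTop_of_le fun _ => by lia
  have hq := tendsto_pow_atTop_nhds_zero_of_norm_lt_one h.sq_lt
  have hN : Tendsto (fun k : ℕ => certPoly s (x * (s ^ 2) ^ n) ((s ^ 2) ^ (k + 1))) atTop
      (𝓝 (certPoly s (x * (s ^ 2) ^ n) 0)) := by
    have hc : Continuous (certPoly s (x * (s ^ 2) ^ n)) := by
      unfold certPoly
      fun_prop
    exact (hc.tendsto 0).comp ((tendsto_add_atTop_iff_nat 1).2 hq)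
  have hA := tendsto_one_sub_mul_pow (x ^ 2 * s ^ 2) h.sq_lt
  have := (h.tendsto_base n).mul (((hN.const_mul s).mul
    (((tendsto_one_sub_mul_pow (x * s) h.sq_lt).comp e1).pow 3)).div
    (((hA.comp e2).pow 3).mul (((hA.comp (tendsto_add_atTop_nat 1)).comp e2).pow 3)) (by simp))
  simp only [zero_mul] at this
  exact this

/-- The WZ equation telescopes in `k`: the upper end vanishes because `wzBase` tends to `0`, and the
lower end is `G(n, 0)`. -/
theorem tsum_phi_succ (h : WZParam s x) (n : ℕ) :
    ∑' k, wzPhi s x (n + 1) k - ∑' k, wzPhi s x n k = -wzG0 s x n := by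
  have h1 := ((h.summable_phi (n + 1)).hasSum.sub (h.summable_phi n).hasSum).tendsto_sum_nat
  have h2 := (tendsto_add_atTop_iff_nat 1).2 h1
  simp_rw [h.sum_range_wz n] at h2
  have h3 := (h.tendsto_H n).sub_const (wzG0 s x n)
  rw [zero_sub] at h3
  exact tendsto_nhds_unique h2 h3

/-- Telescoping in `n` only controls ordered partial sums. The explicit factor `q^n` in `G(n, 0)`,
all else being bounded, supplies absolute summability. -/
theorem exists_norm_G0_le (h : WZParam s x) :
    ∃ C : ℝ, ∀ n, ‖wzG0 s x n‖ ≤ C * ‖s ^ 2‖ ^ n := by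
  have e2 : Tendsto (fun k : ℕ => 2 * k) atTop atTop :=
    tendsto_atTop_of_le fun _ => by lia
  have e3 : Tendsto (fun k : ℕ => 3 * k) atTop atTop :=
    tendsto_atTop_of_le fun _ => by lia
  have hy : Tendsto (fun n : ℕ => x * (s ^ 2) ^ n) atTop (𝓝 0) := by
    simpa using (tendsto_pow_atTop_nhds_zero_of_norm_lt_one h.sq_lt).const_mul x
  have hP : Tendsto (fun n : ℕ => polyP (s ^ 2) s (x * (s ^ 2) ^ n)) atTop
      (𝓝 (polyP (s ^ 2) s 0)) := by
    have hc : Continuous (polyP (s ^ 2) s) := by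
      unfold polyP
      fun_prop
    exact (hc.tendsto 0).comp hy
  have hU := tendsto_qPoch (x * s) h.sq_lt
  have hb : Tendsto (fun n => wzBase s x n 0) atTop (𝓝 (wzConst s x * (1 / (1 - s)))) := by
    have := ((hU.pow 3).mul (hU.pow 3)).mul ((tendsto_qPoch (x ^ 3 * s ^ 2) h.sq_lt).comp e3) |>.mul
      (((tendsto_qPoch_inv h.sq_lt h.x_ne).pow 3).mul
        (((tendsto_qPoch_inv h.sq_lt h.sq_ne).comp e2).pow 3)) |>.mul_const (1 / (1 - s))
    convert this using 2
    · simp only [wzBase, Function.comp, add_zero, pow_zero, zero_add, one_mul,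
        show qPoch s (s ^ 2) 1 = 1 - s by simp [qPoch], div_eq_mul_inv, mul_inv, inv_pow]
      ring
    · simp only [wzConst, div_eq_mul_inv, mul_inv, inv_pow]
      ring
  have hA : Tendsto (fun n : ℕ => ((1 - x ^ 2 * s ^ 2 * (s ^ 2) ^ (2 * n)) ^ 3 *
      (1 + x * (s ^ 2) ^ n + (x * (s ^ 2) ^ n) ^ 2))⁻¹) atTop
      (𝓝 (((1 : ℂ) ^ 3 * (1 + 0 + 0 ^ 2))⁻¹)) := by
    refine Tendsto.inv₀ ?_ (by simp)
    exact (((tendsto_one_sub_mul_pow (x ^ 2 * s ^ 2) h.sq_lt).comp e2).pow 3).mul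
      ((hy.const_add 1).add (hy.pow 2))
  obtain ⟨C, -, hC⟩ := exists_norm_le_of_tendsto ((hb.mul (hP.const_mul ((1 - s) * x))).mul hA)
  refine ⟨C, fun n => ?_⟩
  have : wzG0 s x n = (wzBase s x n 0 * ((1 - s) * x * polyP (s ^ 2) s (x * (s ^ 2) ^ n)) *
      ((1 - x ^ 2 * s ^ 2 * (s ^ 2) ^ (2 * n)) ^ 3 *
      (1 + x * (s ^ 2) ^ n + (x * (s ^ 2) ^ n) ^ 2))⁻¹) * (s ^ 2) ^ n := by
    rw [wzG0, div_eq_mul_inv]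
    ring
  rw [this, norm_mul, norm_pow (s ^ 2) n]
  exact mul_le_mul_of_nonneg_right (hC n) (by positivity)

theorem hasSum_G0 (h : WZParam s x) :
    HasSum (wzG0 s x) (∑' k, wzPhi s x 0 k -
      wzConst s x * ∑' k, s ^ k / qPoch s (s ^ 2) (k + 1)) := by
  have hs : Summable (wzG0 s x) := by
    obtain ⟨C, hC⟩ := h.exists_norm_G0_le
    exact Summable.of_norm_bounded
      ((summable_geometric_of_lt_one (norm_nonneg _) h.sq_lt).mul_left C) hC
  have h1 : ∀ N, ∑ n ∈ Finset.range N, wzG0 s x n =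
      ∑' k, wzPhi s x 0 k - ∑' k, wzPhi s x N k := by
    intro N
    induction N with
    | zero => simp
    | succ N ih =>
      rw [Finset.sum_range_succ, ih]
      linear_combination h.tsum_phi_succ N
  have h2 := hs.hasSum.tendsto_sum_nat
  simp_rw [h1] at h2
  rw [tendsto_nhds_unique (h.tendsto_tsum_phi.const_sub _) h2]
  exact hs.hasSum

end WZParam

/-! ### Auxiliary facts on telescoping and powers -/

theorem tsum_sub_succ {v : ℕ → ℂ} {l : ℂ} (hv : Tendsto v atTop (𝓝 l))
    (hs : Summable fun m => v m - v (m + 1)) : ∑' m, (v m - v (m + 1)) = v 0 - l := by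
  refine tendsto_nhds_unique hs.hasSum.tendsto_sum_nat ?_
  simp_rw [Finset.sum_range_sub' v]
  exact hv.const_sub _

theorem sq_norm_lt {s : ℂ} (hs : ‖s‖ < 1) : ‖s ^ 2‖ < 1 := by
  rw [norm_pow]
  exact pow_lt_one₀ (norm_nonneg _) hs two_ne_zero

theorem norm_pow_le_pow_of_le {q : ℂ} (hq : ‖q‖ < 1) {m n : ℕ} (h : m ≤ n) :
    ‖q ^ n‖ ≤ ‖q‖ ^ m := by
  rw [norm_pow]
  exact pow_le_pow_of_le_one (norm_nonneg _) hq.le h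

theorem qPoch_self_ne_zero {q : ℂ} (hq : ‖q‖ < 1) (n : ℕ) : qPoch q q n ≠ 0 :=
  qPoch_ne_zero (one_sub_mul_pow_ne_zero hq hq) n

/-! ### Cauchy's sum for `1 / (q; q)_∞` -/

/-- The summand `q ^ (m ^ 2 + N m) / ((q; q)_m (q; q)_{N + m})`. -/
def cauchyTerm (q : ℂ) (N m : ℕ) : ℂ :=
  q ^ (m ^ 2 + N * m) / (qPoch q q m * qPoch q q (N + m))

/-- The part `N * m` of the exponent is kept because it makes the terms with `m ≥ 1` disappear as `N
→ ∞`. -/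
theorem exists_norm_cauchyTerm_le {q : ℂ} (hq : ‖q‖ < 1) :
    ∃ C : ℝ, 0 ≤ C ∧ ∀ N m, ‖cauchyTerm q N m‖ ≤ C * ‖q‖ ^ (m + N * m) := by
  obtain ⟨C, p, h⟩ := exists_norm_le_of_tendsto
    (tendsto_qPoch_inv hq (one_sub_mul_pow_ne_zero hq hq))
  refine ⟨C * C, by positivity, fun N m => ?_⟩
  rw [cauchyTerm, div_eq_mul_inv, mul_inv, mul_comm]
  exact norm_mul_le_of_le (norm_mul_le_of_le (h _) (h _))
    (norm_pow_le_pow_of_le hq (by gcongr; exact Nat.le_self_pow two_ne_zero m))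

theorem summable_cauchyTerm {q : ℂ} (hq : ‖q‖ < 1) (N : ℕ) : Summable (cauchyTerm q N) := by
  obtain ⟨C, hC, h⟩ := exists_norm_cauchyTerm_le hq
  refine Summable.of_norm_bounded
    ((summable_geometric_of_lt_one (norm_nonneg _) hq).mul_left C) fun m => (h N m).trans ?_
  exact mul_le_mul_of_nonneg_left
    (pow_le_pow_of_le_one (norm_nonneg _) hq.le (Nat.le_add_right _ _)) hC

/-- The difference of the summands for `N` and `N + 1` telescopes in `m` through `cauchyTerm q N m *
(1 - q^m)`, which is `0` at `m = 0` and tends to `0`. -/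
theorem tsum_cauchyTerm_succ {q : ℂ} (hq : ‖q‖ < 1) (N : ℕ) :
    ∑' m, cauchyTerm q (N + 1) m = ∑' m, cauchyTerm q N m := by
  have hd : ∀ m, cauchyTerm q N m - cauchyTerm q (N + 1) m =
      cauchyTerm q N m * (1 - q ^ m) - cauchyTerm q N (m + 1) * (1 - q ^ (m + 1)) := by
    intro m
    have h1 := qPoch_self_ne_zero hq m
    have h2 := qPoch_self_ne_zero hq (N + m)
    have h3 := one_sub_mul_pow_ne_zero hq hq m
    have h4 := one_sub_mul_pow_ne_zero hq hq (N + m)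
    rw [cauchyTerm, cauchyTerm, cauchyTerm, show N + 1 + m = N + m + 1 by ring,
      show N + (m + 1) = N + m + 1 by ring, qPoch_succ _ _ m, qPoch_succ _ _ (N + m)]
    rw [show 1 - q ^ (m + 1) = 1 - q * q ^ m by ring]
    field_simp
    ring
  have hs := (summable_cauchyTerm hq N).sub (summable_cauchyTerm hq (N + 1))
  have ht : Tendsto (fun m => cauchyTerm q N m * (1 - q ^ m)) atTop (𝓝 (0 * 1)) :=
    (summable_cauchyTerm hq N).tendsto_atTop_zero.mul
      (by simpa using tendsto_one_sub_mul_pow 1 hq)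
  have := tsum_sub_succ ht (by simpa only [← hd] using hs)
  simp only [← hd] at this
  rw [(summable_cauchyTerm hq N).tsum_sub (summable_cauchyTerm hq (N + 1))] at this
  simp only [pow_zero, sub_self, mul_zero, zero_mul] at this
  exact (sub_eq_zero.1 this).symm

/-- The sum does not depend on `N`. As `N → ∞` only the term `m = 0` survives, and it tends to `1 /
(q; q)_∞`. -/
theorem tsum_cauchyTerm {q : ℂ} (hq : ‖q‖ < 1) (N : ℕ) :
    ∑' m, cauchyTerm q N m = (qPochInf q q)⁻¹ := by
  have hc : ∀ n, ∑' m, cauchyTerm q (N + n) m = ∑' m, cauchyTerm q N m := by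
    intro n
    induction n with
    | zero => rfl
    | succ n ih => rw [← add_assoc, tsum_cauchyTerm_succ hq, ih]
  obtain ⟨C, hC, h⟩ := exists_norm_cauchyTerm_le hq
  have ht : Tendsto (fun n => ∑' m, cauchyTerm q (N + n) m) atTop
      (𝓝 (∑' m, if m = 0 then (qPochInf q q)⁻¹ else 0)) := by
    refine tendsto_tsum_of_dominated_convergence
      ((summable_geometric_of_lt_one (norm_nonneg _) hq).mul_left C) (fun m => ?_)
      (Eventually.of_forall fun n m => (h _ m).trans ?_)
    · have e : Tendsto (fun n : ℕ => N + n) atTop atTop :=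
        tendsto_atTop_of_le fun _ => by lia
      rcases m with _ | m
      · have := (tendsto_qPoch_inv hq (one_sub_mul_pow_ne_zero hq hq)).comp e
        simpa [cauchyTerm, qPoch_zero, Function.comp_def] using this
      · simp only [Nat.add_eq_zero_iff, one_ne_zero, and_false, if_false]
        refine squeeze_zero_norm (fun n => h (N + n) (m + 1)) ?_
        have e2 : Tendsto (fun n : ℕ => m + 1 + (N + n) * (m + 1)) atTop atTop :=
          tendsto_atTop_of_le fun n => by nlinarith [Nat.zero_le (n * m), Nat.zero_le (N * (m + 1))]
        simpa using ((tendsto_pow_atTop_nhds_zero_of_lt_one (norm_nonneg _) hq).comp e2).const_mul C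
    · exact mul_le_mul_of_nonneg_left
        (pow_le_pow_of_le_one (norm_nonneg _) hq.le (Nat.le_add_right _ _)) hC
  rw [tsum_ite_eq] at ht
  simp_rw [hc] at ht
  exact tendsto_nhds_unique tendsto_const_nhds ht

/-! ### The Rogers-Fine transformation -/

/-- The summand `(s q ^ j) ^ k / (s; q)_{j + k + 1}` with `q = s ^ 2`. -/
def fineTerm (s : ℂ) (j k : ℕ) : ℂ := (s * (s ^ 2) ^ j) ^ k / qPoch s (s ^ 2) (j + 1 + k)

theorem exists_norm_fineTerm_le {s : ℂ} (hs : ‖s‖ < 1) :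
    ∃ C : ℝ, 0 ≤ C ∧ ∀ j k, ‖fineTerm s j k‖ ≤ C * ‖s‖ ^ k := by
  obtain ⟨C, p, h⟩ := exists_norm_le_of_tendsto
    (tendsto_qPoch_inv (sq_norm_lt hs) (one_sub_mul_pow_ne_zero hs (sq_norm_lt hs)))
  refine ⟨C, p, fun j k => ?_⟩
  rw [fineTerm, div_eq_mul_inv, mul_comm]
  refine norm_mul_le_of_le (h _) ?_
  rw [norm_pow, norm_mul]
  refine pow_le_pow_left₀ (by positivity) (mul_le_of_le_one_right (norm_nonneg _) ?_) k
  exact (norm_pow_le_pow_of_le (sq_norm_lt hs) (Nat.zero_le j)).trans_eq (pow_zero _)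

theorem summable_fineTerm {s : ℂ} (hs : ‖s‖ < 1) (j : ℕ) : Summable (fineTerm s j) := by
  obtain ⟨C, -, h⟩ := exists_norm_fineTerm_le hs
  exact Summable.of_norm_bounded
    ((summable_geometric_of_lt_one (norm_nonneg _) hs).mul_left C) (h j)

theorem tsum_fineTerm_succ {s : ℂ} (hs : ‖s‖ < 1) (j : ℕ) :
    (1 - s * (s ^ 2) ^ j) * ∑' k, fineTerm s j k -
      (s ^ 2) ^ (2 * j + 2) * ∑' k, fineTerm s (j + 1) k = (qPoch s (s ^ 2) (j + 1))⁻¹ := by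
  have hd : ∀ k, (1 - s * (s ^ 2) ^ j) * fineTerm s j k -
      (s ^ 2) ^ (2 * j + 2) * fineTerm s (j + 1) k = fineTerm s j k - fineTerm s j (k + 1) := by
    intro k
    have h1 := qPoch_ne_zero (one_sub_mul_pow_ne_zero hs (sq_norm_lt hs)) (j + 1 + k)
    have h2 := one_sub_mul_pow_ne_zero hs (sq_norm_lt hs) (j + 1 + k)
    rw [fineTerm, fineTerm, fineTerm, show j + 1 + 1 + k = j + 1 + k + 1 by ring,
      show j + 1 + (k + 1) = j + 1 + k + 1 by ring, qPoch_succ _ _ (j + 1 + k)]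
    rw [show s * (s ^ 2) ^ (j + 1 + k) = s ^ 2 * (s * (s ^ 2) ^ j) * (s ^ 2) ^ k by ring,
      show (s * (s ^ 2) ^ (j + 1)) ^ k = (s * (s ^ 2) ^ j) ^ k * (s ^ 2) ^ k by ring,
      show (s ^ 2) ^ (2 * j + 2) = (s * (s ^ 2) ^ j) ^ 2 * s ^ 2 by ring] at *
    generalize s * (s ^ 2) ^ j = t at *
    rw [pow_succ t]
    generalize (s ^ 2) ^ k = w at *
    obtain ⟨B, hB⟩ : ∃ B, B = 1 - s ^ 2 * t * w := ⟨_, rfl⟩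
    rw [← hB] at h2 ⊢
    field_simp
    rw [hB]
    ring
  have ht := (summable_fineTerm hs j).tendsto_atTop_zero
  have hs1 := (summable_fineTerm hs j).mul_left (1 - s * (s ^ 2) ^ j)
  have hs2 := (summable_fineTerm hs (j + 1)).mul_left ((s ^ 2) ^ (2 * j + 2))
  have := tsum_sub_succ ht (by simpa only [← hd] using hs1.sub hs2)
  simp only [← hd] at this
  rw [hs1.tsum_sub hs2, tsum_mul_left, tsum_mul_left] at this
  rw [this]
  simp [fineTerm]

/-- Iterating the recurrence of `tsum_fineTerm_succ` from `j = 0` produces one summand of the new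
series at each step. The remainder `K j` carries `q^(j²+j)` and dies out. -/
theorem tendsto_rogersFine {s : ℂ} (hs : ‖s‖ < 1) :
    Tendsto (fun N => ∑ n ∈ Finset.range N,
      (s ^ 2) ^ (n ^ 2 + n) / qPoch s (s ^ 2) (n + 1) ^ 2) atTop
      (𝓝 (∑' k, s ^ k / qPoch s (s ^ 2) (k + 1))) := by
  have hne := one_sub_mul_pow_ne_zero hs (sq_norm_lt hs)
  set K : ℕ → ℂ := fun j =>
    (s ^ 2) ^ (j ^ 2 + j) * (∑' k, fineTerm s j k) / qPoch s (s ^ 2) j with hK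
  have hd : ∀ j, (s ^ 2) ^ (j ^ 2 + j) / qPoch s (s ^ 2) (j + 1) ^ 2 = K j - K (j + 1) := by
    intro j
    have h := tsum_fineTerm_succ hs j
    have h1 := qPoch_ne_zero hne j
    have h2 := hne j
    simp only [hK]
    rw [show (j + 1) ^ 2 + (j + 1) = j ^ 2 + j + (2 * j + 2) by ring, pow_add _ (j ^ 2 + j)]
    rw [qPoch_succ] at *
    generalize (∑' k, fineTerm s j k) = X at *
    generalize (∑' k, fineTerm s (j + 1) k) = Y at *
    generalize 1 - s * (s ^ 2) ^ j = t at *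
    generalize (s ^ 2) ^ (2 * j + 2) = w at *
    generalize (s ^ 2) ^ (j ^ 2 + j) = v at *
    field_simp at h ⊢
    linear_combination -v * h
  have h0 : K 0 = ∑' k, s ^ k / qPoch s (s ^ 2) (k + 1) := by
    simp [hK, fineTerm, qPoch_zero, add_comm]
  simp_rw [hd, Finset.sum_range_sub', h0]
  obtain ⟨C, hC, h⟩ := exists_norm_fineTerm_le hs
  obtain ⟨C', p, h'⟩ := exists_norm_le_of_tendsto (tendsto_qPoch_inv (sq_norm_lt hs) hne)
  have hg := (summable_geometric_of_lt_one (norm_nonneg _) hs).mul_left C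
  have hK0 : Tendsto K atTop (𝓝 0) := by
    refine squeeze_zero_norm (a := fun j => ‖s ^ 2‖ ^ j * (∑' k, C * ‖s‖ ^ k) * C') (fun j => ?_) ?_
    · simp only [hK, div_eq_mul_inv]
      exact norm_mul_le_of_le (norm_mul_le_of_le
        (norm_pow_le_pow_of_le (sq_norm_lt hs) (Nat.le_add_left _ _))
        (tsum_of_norm_bounded hg.hasSum (h j))) (h' j)
    · simpa using ((tendsto_pow_atTop_nhds_zero_of_lt_one (norm_nonneg _)
        (sq_norm_lt hs)).mul_const (∑' k, C * ‖s‖ ^ k)).mul_const C'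
  simpa using hK0.const_sub _

/-! ### A Bailey pair -/

/-- `α_r = (-1)^r q^(r(r+1)/2) (1 + s q^r) / (1 - s q^r)` with `q = s ^ 2`. -/
def baileyAlpha (s : ℂ) (r : ℕ) : ℂ :=
  (-1) ^ r * s ^ (r * (r + 1)) * ((1 + s * (s ^ 2) ^ r) / (1 - s * (s ^ 2) ^ r))

/-- A closed form for partial sums of the series that must vanish. The upper parameter is `N = R +
d`; the induction on `R` keeps `N` fixed by passing from `d + 1` to `d`. The factor `1 - q^N` is
kept on the left to avoid a division. -/
theorem sum_range_bailey {s : ℂ} (hs : ‖s‖ < 1) (d R : ℕ) :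
    (1 - (s ^ 2) ^ (R + d)) * ∑ r ∈ Finset.range R, (-1) ^ r * s ^ (r * (r + 1)) *
      (s ^ 2) ^ (R + d - r) * (1 - (s ^ 2) ^ (2 * r + 1)) /
        (qPoch (s ^ 2) (s ^ 2) (R + d - r) * qPoch (s ^ 2) (s ^ 2) (R + d + r + 1)) =
    -((-1) ^ R * s ^ (R * (R + 1)) * (s ^ 2) ^ d * (1 - (s ^ 2) ^ R) /
      (qPoch (s ^ 2) (s ^ 2) d * qPoch (s ^ 2) (s ^ 2) (R + d + R))) := by
  have hq := sq_norm_lt hs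
  induction R generalizing d with
  | zero => simp
  | succ R ih =>
    have h := ih (d + 1)
    have h1 := qPoch_self_ne_zero hq d
    have h2 := qPoch_self_ne_zero hq (R + d + 1 + R)
    have h3 := one_sub_mul_pow_ne_zero hq hq d
    have h4 := one_sub_mul_pow_ne_zero hq hq (R + d + 1 + R)
    rw [Finset.sum_range_succ, mul_add]
    simp only [show R + (d + 1) = R + 1 + d by ring] at h
    rw [h, show R + 1 + d - R = d + 1 by lia, show R + 1 + d + R = R + d + 1 + R by ring,
      show R + 1 + d + (R + 1) = R + d + 1 + R + 1 by ring, qPoch_succ _ _ d,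
      qPoch_succ _ _ (R + d + 1 + R)]
    field_simp
    ring

theorem sum_bailey_eq_zero {s : ℂ} (hs : ‖s‖ < 1) (n : ℕ) :
    ∑ r ∈ Finset.range (n + 2), (-1) ^ r * s ^ (r * (r + 1)) *
      (s ^ 2) ^ (n + 1 - r) * (1 - (s ^ 2) ^ (2 * r + 1)) /
        (qPoch (s ^ 2) (s ^ 2) (n + 1 - r) * qPoch (s ^ 2) (s ^ 2) (n + 1 + r + 1)) = 0 := by
  have hq := sq_norm_lt hs
  have h0 : 1 - (s ^ 2) ^ (n + 1) ≠ 0 := by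
    simpa [pow_succ'] using one_sub_mul_pow_ne_zero hq hq n
  have h := sum_range_bailey hs 0 (n + 1)
  simp only [add_zero] at h
  refine (mul_eq_zero.1 ?_).resolve_left h0
  rw [Finset.sum_range_succ, mul_add, h]
  have h2 := qPoch_self_ne_zero hq (n + 1 + (n + 1))
  have h4 := one_sub_mul_pow_ne_zero hq hq (n + 1 + (n + 1))
  rw [Nat.sub_self, qPoch_succ _ _ (n + 1 + (n + 1)), qPoch_zero]
  field_simp
  ring

/-- The Bailey pair relative to `q`, by induction on `n`. The point is that `(1 - s q^(n+1))² - (1 -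
q^(n+1-r)) (1 - q^(n+r+2)) = q^(n+1-r) (1 - s q^r)²`, because `s² = q`. Multiplied by `baileyAlpha s
r`, one factor `1 - s q^r` cancels and the other completes `1 - q^(2r+1)`, so the discrepancy is the
vanishing sum `sum_bailey_eq_zero`. -/
theorem sum_baileyAlpha {s : ℂ} (hs : ‖s‖ < 1) (n : ℕ) :
    ∑ r ∈ Finset.range (n + 1), baileyAlpha s r /
      (qPoch (s ^ 2) (s ^ 2) (n - r) * qPoch (s ^ 2) (s ^ 2) (n + r + 1)) =
    1 / qPoch s (s ^ 2) (n + 1) ^ 2 := by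
  have hq := sq_norm_lt hs
  have hne := one_sub_mul_pow_ne_zero hs hq
  induction n with
  | zero =>
    have h1 := hne 0
    have h2 := one_sub_mul_pow_ne_zero hq hq 0
    have h3 : 1 + s ≠ 0 := by
      simpa using one_sub_ne_zero_of_norm_lt_one (z := -s) (by simpa using hs)
    simp [baileyAlpha, qPoch] at *
    rw [show 1 - s ^ 2 = (1 - s) * (1 + s) by ring]
    field_simp
  | succ n ih =>
    have e : ∑ r ∈ Finset.range (n + 1), baileyAlpha s r /
        (qPoch (s ^ 2) (s ^ 2) (n - r) * qPoch (s ^ 2) (s ^ 2) (n + r + 1)) =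
        ∑ r ∈ Finset.range (n + 2), baileyAlpha s r *
          ((1 - (s ^ 2) ^ (n + 1 - r)) * (1 - (s ^ 2) ^ (n + r + 2))) /
        (qPoch (s ^ 2) (s ^ 2) (n + 1 - r) * qPoch (s ^ 2) (s ^ 2) (n + 1 + r + 1)) := by
      rw [Finset.sum_range_succ _ (n + 1)]
      simp only [Nat.sub_self, pow_zero, sub_self, zero_mul, mul_zero, zero_div, add_zero]
      refine Finset.sum_congr rfl fun r hr => ?_
      obtain ⟨d, rfl⟩ := Nat.exists_eq_add_of_le (Nat.lt_succ_iff.1 (Finset.mem_range.1 hr))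
      have h1 := qPoch_self_ne_zero hq d
      have h2 := qPoch_self_ne_zero hq (r + d + r + 1)
      have h3 := one_sub_mul_pow_ne_zero hq hq d
      have h4 := one_sub_mul_pow_ne_zero hq hq (r + d + r + 1)
      rw [show r + d - r = d by lia, show r + d + 1 - r = d + 1 by lia,
        show r + d + 1 + r + 1 = r + d + r + 1 + 1 by ring, qPoch_succ _ _ d,
        qPoch_succ _ _ (r + d + r + 1), show (s ^ 2) ^ (d + 1) = s ^ 2 * (s ^ 2) ^ d by ring,
        show (s ^ 2) ^ (r + d + r + 2) = s ^ 2 * (s ^ 2) ^ (r + d + r + 1) by ring]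
      generalize 1 - s ^ 2 * (s ^ 2) ^ d = A at *
      generalize 1 - s ^ 2 * (s ^ 2) ^ (r + d + r + 1) = B at *
      field_simp
    have key : (1 - s * (s ^ 2) ^ (n + 1)) ^ 2 * ∑ r ∈ Finset.range (n + 2), baileyAlpha s r /
        (qPoch (s ^ 2) (s ^ 2) (n + 1 - r) * qPoch (s ^ 2) (s ^ 2) (n + 1 + r + 1)) =
        1 / qPoch s (s ^ 2) (n + 1) ^ 2 := by
      rw [← ih, e, ← sub_eq_zero, ← sum_bailey_eq_zero hs n, Finset.mul_sum,
        ← Finset.sum_sub_distrib]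
      refine Finset.sum_congr rfl fun r hr => ?_
      obtain ⟨d, hd⟩ := Nat.exists_eq_add_of_le (Nat.lt_succ_iff.1 (Finset.mem_range.1 hr))
      rw [hd, show r + d - r = d by lia, show n + r + 2 = r + d + r + 1 by lia, baileyAlpha,
        ← mul_div_assoc, ← sub_div]
      congr 1
      have h5 := hne r
      field_simp
      ring
    rw [qPoch_succ _ _ (n + 1)]
    have h1 := qPoch_ne_zero hne (n + 1)
    have h2 := hne (n + 1)
    field_simp at key ⊢
    linear_combination key

theorem exists_norm_baileyAlpha_le {s : ℂ} (hs : ‖s‖ < 1) :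
    ∃ C : ℝ, 0 ≤ C ∧ ∀ r, ‖baileyAlpha s r‖ ≤ C := by
  have h1 : Tendsto (fun r : ℕ => 1 + s * (s ^ 2) ^ r) atTop (𝓝 1) := by
    simpa using tendsto_one_sub_mul_pow (-s) (sq_norm_lt hs)
  obtain ⟨C, hC, h⟩ := exists_norm_le_of_tendsto
    (h1.div (tendsto_one_sub_mul_pow s (sq_norm_lt hs)) one_ne_zero)
  refine ⟨1 * C, by simpa using hC, fun r => norm_mul_le_of_le ?_ (h r)⟩
  rw [norm_mul, norm_pow, norm_neg, norm_one, one_pow, one_mul, norm_pow]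
  exact pow_le_one₀ (norm_nonneg _) hs.le

theorem altTerm_eq (s : ℂ) (r : ℕ) :
    altTerm s r = (1 - s) / (1 + s) * (baileyAlpha s r * (s ^ 2) ^ (r ^ 2 + r)) := by
  rw [altTerm, baileyAlpha, show s * (s ^ 2) ^ r = s ^ (1 + 2 * r) by ring,
    show s ^ (3 * r * (r + 1)) = s ^ (r * (r + 1)) * (s ^ 2) ^ (r ^ 2 + r) by ring]
  simp only [div_eq_mul_inv]
  ring

theorem summable_altTerm {s : ℂ} (hs : ‖s‖ < 1) : Summable (altTerm s) := by
  obtain ⟨C, -, h⟩ := exists_norm_baileyAlpha_le hs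
  have : Summable fun r => baileyAlpha s r * (s ^ 2) ^ (r ^ 2 + r) :=
    Summable.of_norm_bounded
      ((summable_geometric_of_lt_one (norm_nonneg _) (sq_norm_lt hs)).mul_left C) fun r =>
        norm_mul_le_of_le (h r) (norm_pow_le_pow_of_le (sq_norm_lt hs) (Nat.le_add_left _ _))
  exact (this.mul_left _).congr fun r => (altTerm_eq s r).symm

/-- One absolutely convergent double series over `(r, m)` is summed in two ways. Along the
antidiagonals `r + m = n` it gives the Rogers-Fine series through the Bailey pair; along rows it
gives Cauchy's sum with `N = 2r + 1`. The exponents agree since `(r+m)² + (r+m) = (r² + r) + (m² +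
(2r+1) m)`. -/
theorem tsum_pow_div_qPoch_aux {s : ℂ} (hs : ‖s‖ < 1) :
    ∑' k, s ^ k / qPoch s (s ^ 2) (k + 1) =
      ∑' r, baileyAlpha s r * (s ^ 2) ^ (r ^ 2 + r) * (qPochInf (s ^ 2) (s ^ 2))⁻¹ := by
  have hq := sq_norm_lt hs
  set f : ℕ × ℕ → ℂ := fun p =>
    baileyAlpha s p.1 * (s ^ 2) ^ (p.1 ^ 2 + p.1) * cauchyTerm (s ^ 2) (2 * p.1 + 1) p.2 with hf
  have hsum : Summable f := by
    obtain ⟨C, hC0, hC⟩ := exists_norm_baileyAlpha_le hs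
    obtain ⟨D, hD0, hD⟩ := exists_norm_cauchyTerm_le hq
    have hg := summable_geometric_of_lt_one (norm_nonneg _) hq
    have hg2 := (hg.mul_of_nonneg hg (fun _ => by positivity) (fun _ => by positivity)).mul_left
      (C * D)
    refine Summable.of_norm_bounded hg2 fun p => ?_
    refine (norm_mul_le_of_le (norm_mul_le_of_le (hC p.1)
      (norm_pow_le_pow_of_le hq (Nat.le_add_left p.1 _)))
      ((hD _ p.2).trans (mul_le_mul_of_nonneg_left
        (pow_le_pow_of_le_one (norm_nonneg _) hq.le (Nat.le_add_right p.2 _)) hD0))).trans_eq ?_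
    ring
  have h1 : ∑' p, f p = ∑' r, baileyAlpha s r * (s ^ 2) ^ (r ^ 2 + r) *
      (qPochInf (s ^ 2) (s ^ 2))⁻¹ := by
    rw [hsum.tsum_prod]
    refine tsum_congr fun r => ?_
    simp only [hf]
    rw [tsum_mul_left, tsum_cauchyTerm hq]
  have hsum' : Summable fun p : Σ n : ℕ, Finset.HasAntidiagonal.antidiagonal n => f p.2.1 :=
    Finset.HasAntidiagonal.sigmaAntidiagonalEquivProd.summable_iff.2 hsum
  have hinner : ∀ n : ℕ, ∑' p : Finset.HasAntidiagonal.antidiagonal n, f p.1 =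
      (s ^ 2) ^ (n ^ 2 + n) / qPoch s (s ^ 2) (n + 1) ^ 2 := by
    intro n
    rw [Finset.tsum_subtype (Finset.HasAntidiagonal.antidiagonal n) f,
      Finset.Nat.sum_antidiagonal_eq_sum_range_succ_mk, div_eq_mul_one_div,
      ← sum_baileyAlpha hs n, Finset.mul_sum]
    refine Finset.sum_congr rfl fun r hr => ?_
    obtain ⟨d, rfl⟩ := Nat.exists_eq_add_of_le (Nat.lt_succ_iff.1 (Finset.mem_range.1 hr))
    simp only [hf, cauchyTerm]
    rw [show r + d - r = d by lia, show 2 * r + 1 + d = r + d + r + 1 by ring,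
      show (r + d) ^ 2 + (r + d) = (r ^ 2 + r) + (d ^ 2 + (2 * r + 1) * d) by ring, pow_add]
    ring
  have h2 := (hsum'.hasSum.sigma fun n => (hsum'.sigma_factor n).hasSum).tendsto_sum_nat
  simp only [hinner] at h2
  rw [tendsto_nhds_unique (tendsto_rogersFine hs) h2, ← h1]
  exact Finset.HasAntidiagonal.sigmaAntidiagonalEquivProd.tsum_eq f

theorem tsum_pow_div_qPoch {s : ℂ} (hs : ‖s‖ < 1) :
    ∑' k, s ^ k / qPoch s (s ^ 2) (k + 1) =
      (1 + s) / ((1 - s) * qPochInf (s ^ 2) (s ^ 2)) * ∑' r, altTerm s r := by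
  have h1 : 1 - s ≠ 0 := one_sub_ne_zero_of_norm_lt_one hs
  have h2 : 1 + s ≠ 0 := by
    simpa using one_sub_ne_zero_of_norm_lt_one (z := -s) (by simpa using hs)
  rw [tsum_pow_div_qPoch_aux hs, tsum_mul_right]
  simp_rw [altTerm_eq]
  rw [tsum_mul_left]
  field_simp

/-! ### The `q`-gamma function -/

theorem norm_ofReal_lt_one {q : ℝ} (h0 : 0 < q) (h1 : q < 1) : ‖(q : ℂ)‖ < 1 := by
  rwa [Complex.norm_real, Real.norm_of_nonneg h0.le]

theorem ofReal_one_sub_ne_zero {q : ℝ} (h1 : q < 1) : (1 - (q : ℂ)) ≠ 0 := by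
  rw [sub_ne_zero]
  exact_mod_cast h1.ne'

theorem qGamma_add_nat {q : ℝ} (h0 : 0 < q) (h1 : q < 1) {z : ℂ}
    (hz : ∀ i : ℕ, 1 - (q : ℂ) ^ z * (q : ℂ) ^ i ≠ 0) (n : ℕ) :
    qGamma q (z + n) = qGamma q z * qPoch ((q : ℂ) ^ z) q n / (1 - (q : ℂ)) ^ n := by
  have hq0 : (q : ℂ) ≠ 0 := by exact_mod_cast h0.ne'
  have hD := ofReal_one_sub_ne_zero h1
  have hq := norm_ofReal_lt_one h0 h1
  have hp := qPoch_ne_zero hz n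
  rw [qGamma, qGamma, qPochInf_eq_mul ((q : ℂ) ^ z) hq n, Complex.cpow_add _ _ hq0,
    Complex.cpow_natCast, show 1 - (z + n) = 1 - z - n by ring, Complex.cpow_sub (1 - z) _ hD,
    Complex.cpow_natCast]
  field_simp

theorem qGamma_ne_zero {q : ℝ} (h0 : 0 < q) (h1 : q < 1) {z : ℂ}
    (hz : ∀ i : ℕ, 1 - (q : ℂ) ^ z * (q : ℂ) ^ i ≠ 0) : qGamma q z ≠ 0 := by
  have hD := ofReal_one_sub_ne_zero h1
  have hq := norm_ofReal_lt_one h0 h1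
  refine div_ne_zero (mul_ne_zero ?_ (qPochInf_ne_zero hq (one_sub_mul_pow_ne_zero hq hq)))
    (qPochInf_ne_zero hq hz)
  rw [Complex.cpow_def_of_ne_zero hD]
  exact Complex.exp_ne_zero _

/-- Under the hypothesis, `w q^(n-1-j)` is the inverse of `v q^j`, so reversing the product matches
factors in pairs. -/
theorem qPoch_reverse {w v q : ℂ} {n : ℕ} (hq : q ≠ 0) (h : w * v * q ^ n = q) :
    qPoch w q n * ∏ j ∈ Finset.range n, -(v * q ^ j) = qPoch v q n := by
  rw [qPoch, ← Finset.prod_range_reflect, ← Finset.prod_mul_distrib]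
  refine Finset.prod_congr rfl fun j hj => ?_
  obtain ⟨d, rfl⟩ := Nat.exists_eq_add_of_lt (Finset.mem_range.1 hj)
  rw [show j + d + 1 - 1 - j = d by lia]
  have : w * v * q ^ (j + d) = 1 := by
    refine mul_right_cancel₀ hq ?_
    linear_combination h
  linear_combination this

/-- Serves the quotient of `Γ_q(1 - n - a)` by `Γ_q(1/2 - n - a)`: the reversal factors cancel
except for `s^n`. -/
theorem qPoch_reverse_ratio {w v w' s q : ℂ} {n : ℕ} (hq : q ≠ 0)
    (hw : w * v * q ^ n = q) (hw' : w' * (v * s) * q ^ n = q) :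
    qPoch w' q n * s ^ n * qPoch v q n = qPoch w q n * qPoch (v * s) q n := by
  have e1 := qPoch_reverse hq hw
  have e2 := qPoch_reverse hq hw'
  have e3 : ∏ j ∈ Finset.range n, -(v * s * q ^ j) =
      s ^ n * ∏ j ∈ Finset.range n, -(v * q ^ j) := by
    rw [← Finset.card_range n, ← Finset.prod_const, Finset.card_range,
      ← Finset.prod_mul_distrib]
    exact Finset.prod_congr rfl fun j _ => by ring
  rw [e3] at e2
  rw [← e1, ← e2]
  ring

/-! ### Translation from `q` and `a` to `s` and `x` -/

/-- The standing hypotheses on `q` and `a`, with `s = q ^ (1/2)` and `x = q ^ a`. -/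
structure QParam (q : ℝ) (a s x : ℂ) : Prop where
  q_pos : 0 < q
  q_lt : q < 1
  ne : ∀ m : ℤ, (q : ℂ) ^ (2 * a) ≠ (q : ℂ) ^ m ∧ (q : ℂ) ^ (3 * a) ≠ (q : ℂ) ^ m
  s_eq : s = (q : ℂ) ^ (1 / 2 : ℂ)
  x_eq : x = (q : ℂ) ^ a

namespace QParam

variable {q : ℝ} {a s x : ℂ}

theorem q_ne (h : QParam q a s x) : (q : ℂ) ≠ 0 := by exact_mod_cast h.q_pos.ne'

theorem norm_q_lt (h : QParam q a s x) : ‖(q : ℂ)‖ < 1 := norm_ofReal_lt_one h.q_pos h.q_lt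

theorem sq_s (h : QParam q a s x) : s ^ 2 = (q : ℂ) := by
  rw [h.s_eq, ← Complex.cpow_nat_mul]
  norm_num

theorem s_ne (h : QParam q a s x) : s ≠ 0 := by
  intro h0
  have := h.sq_s
  rw [h0] at this
  exact h.q_ne (by simpa using this.symm)

theorem norm_s_lt (h : QParam q a s x) : ‖s‖ < 1 := by
  have := h.norm_q_lt
  rw [← h.sq_s, norm_pow] at this
  exact (pow_lt_one_iff_of_nonneg (norm_nonneg _) two_ne_zero).1 this

theorem x_ne (h : QParam q a s x) : x ≠ 0 := by
  rw [h.x_eq, Complex.cpow_def_of_ne_zero h.q_ne]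
  exact Complex.exp_ne_zero _

theorem cpow_two_mul (h : QParam q a s x) : (q : ℂ) ^ (2 * a) = x ^ 2 := by
  rw [h.x_eq]
  exact_mod_cast Complex.cpow_nat_mul (q : ℂ) 2 a

theorem cpow_three_mul (h : QParam q a s x) : (q : ℂ) ^ (3 * a) = x ^ 3 := by
  rw [h.x_eq]
  exact_mod_cast Complex.cpow_nat_mul (q : ℂ) 3 a

theorem sq_ne (h : QParam q a s x) (m : ℤ) : x ^ 2 ≠ (q : ℂ) ^ m :=
  h.cpow_two_mul ▸ (h.ne m).1

theorem cube_ne (h : QParam q a s x) (m : ℤ) : x ^ 3 ≠ (q : ℂ) ^ m :=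
  h.cpow_three_mul ▸ (h.ne m).2

theorem one_sub_x_ne (h : QParam q a s x) (m : ℤ) : 1 - x * (q : ℂ) ^ m ≠ 0 := by
  intro h0
  refine h.sq_ne (-(2 * m)) ?_
  have h1 : x * (q : ℂ) ^ m = 1 := (sub_eq_zero.1 h0).symm
  have h2 : x ^ 2 * (q : ℂ) ^ (2 * m) = 1 := by
    rw [mul_comm 2 m, zpow_mul, zpow_ofNat]
    rw [← mul_pow, h1, one_pow]
  rw [zpow_neg]
  exact eq_inv_of_mul_eq_one_left h2

theorem one_sub_sq_ne (h : QParam q a s x) (m : ℤ) : 1 - x ^ 2 * (q : ℂ) ^ m ≠ 0 := by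
  intro h0
  refine h.sq_ne (-m) ?_
  rw [zpow_neg]
  exact eq_inv_of_mul_eq_one_left (sub_eq_zero.1 h0).symm

theorem one_sub_cube_ne (h : QParam q a s x) (m : ℤ) : 1 - x ^ 3 * (q : ℂ) ^ m ≠ 0 := by
  intro h0
  refine h.cube_ne (-m) ?_
  rw [zpow_neg]
  exact eq_inv_of_mul_eq_one_left (sub_eq_zero.1 h0).symm

/-- Half-integral shifts are excluded by the condition on `q^(2a)`, since `(x s q^m)² = x²
q^(2m+1)`. -/
theorem one_sub_half_ne (h : QParam q a s x) (m : ℤ) : 1 - x * s * (q : ℂ) ^ m ≠ 0 := by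
  intro h0
  refine h.one_sub_sq_ne (2 * m + 1) ?_
  have h1 : x * s * (q : ℂ) ^ m = 1 := (sub_eq_zero.1 h0).symm
  have h2 : x ^ 2 * (q : ℂ) ^ (2 * m + 1) = (x * s * (q : ℂ) ^ m) ^ 2 := by
    rw [zpow_add₀ h.q_ne, zpow_one, mul_comm 2 m, zpow_mul, zpow_ofNat, mul_pow, mul_pow,
      h.sq_s]
    ring
  rw [h2, h1]
  norm_num

theorem wzParam (h : QParam q a s x) : WZParam s x where
  s_ne := h.s_ne
  s_lt := h.norm_s_lt
  sq_ne i := by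
    have := h.one_sub_sq_ne (i + 1)
    rw [h.sq_s, mul_assoc, ← pow_succ']
    exact_mod_cast this
  cube_ne i := by
    have := h.one_sub_cube_ne (i + 1)
    rw [h.sq_s, mul_assoc, ← pow_succ']
    exact_mod_cast this
  quad_ne h0 := by
    have := h.one_sub_cube_ne 0
    rw [zpow_zero, mul_one] at this
    exact this (by linear_combination (1 - x) * h0)

/-! Values of `q ^ z` and of the products occurring in the `q`-gamma functions. -/

theorem cpow_half_add (h : QParam q a s x) : (q : ℂ) ^ (a + 1 / 2) = x * s := by
  rw [Complex.cpow_add _ _ h.q_ne, h.x_eq, h.s_eq]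

theorem cpow_add_one (h : QParam q a s x) : (q : ℂ) ^ (a + 1) = x * q := by
  rw [Complex.cpow_add _ _ h.q_ne, h.x_eq, Complex.cpow_one]

theorem cpow_two_mul_add_one (h : QParam q a s x) : (q : ℂ) ^ (2 * a + 1) = x ^ 2 * q := by
  rw [Complex.cpow_add _ _ h.q_ne, h.cpow_two_mul, Complex.cpow_one]

theorem cpow_three_mul_add_one (h : QParam q a s x) : (q : ℂ) ^ (3 * a + 1) = x ^ 3 * q := by
  rw [Complex.cpow_add _ _ h.q_ne, h.cpow_three_mul, Complex.cpow_one]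

theorem cpow_one_sub (h : QParam q a s x) (n : ℕ) :
    (q : ℂ) ^ (1 - (n + a)) * x * (q : ℂ) ^ n = q := by
  rw [Complex.cpow_sub _ _ h.q_ne, Complex.cpow_add _ _ h.q_ne, Complex.cpow_natCast,
    Complex.cpow_one, ← h.x_eq]
  have := h.x_ne
  have := h.q_ne
  field_simp

theorem cpow_half_sub (h : QParam q a s x) (n : ℕ) :
    (q : ℂ) ^ (1 / 2 - (n + a)) * (x * s) * (q : ℂ) ^ n = q := by
  rw [Complex.cpow_sub _ _ h.q_ne, Complex.cpow_add _ _ h.q_ne, Complex.cpow_natCast,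
    ← h.x_eq, ← h.s_eq]
  have := h.x_ne
  have := h.q_ne
  field_simp
  exact h.sq_s

theorem ne_half_add (h : QParam q a s x) (i : ℕ) :
    1 - (q : ℂ) ^ (a + 1 / 2) * (q : ℂ) ^ i ≠ 0 := by
  rw [h.cpow_half_add]
  exact_mod_cast h.one_sub_half_ne i

theorem ne_add_one (h : QParam q a s x) (i : ℕ) :
    1 - (q : ℂ) ^ (a + 1) * (q : ℂ) ^ i ≠ 0 := by
  rw [h.cpow_add_one, mul_assoc, ← pow_succ']
  exact_mod_cast h.one_sub_x_ne (i + 1)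

theorem ne_two_mul_add_one (h : QParam q a s x) (i : ℕ) :
    1 - (q : ℂ) ^ (2 * a + 1) * (q : ℂ) ^ i ≠ 0 := by
  rw [h.cpow_two_mul_add_one, mul_assoc, ← pow_succ']
  exact_mod_cast h.one_sub_sq_ne (i + 1)

theorem ne_three_mul_add_one (h : QParam q a s x) (i : ℕ) :
    1 - (q : ℂ) ^ (3 * a + 1) * (q : ℂ) ^ i ≠ 0 := by
  rw [h.cpow_three_mul_add_one, mul_assoc, ← pow_succ']
  exact_mod_cast h.one_sub_cube_ne (i + 1)

theorem ne_one_sub (h : QParam q a s x) (n i : ℕ) :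
    1 - (q : ℂ) ^ (1 - (n + a)) * (q : ℂ) ^ i ≠ 0 := by
  intro h0
  refine h.one_sub_x_ne (n - (i + 1)) ?_
  have h1 := h.cpow_one_sub n
  have h2 := h.q_ne
  have h3 : x * (q : ℂ) ^ n = q ^ (i + 1) := by
    rw [pow_succ]
    linear_combination (q : ℂ) ^ i * h1 + x * (q : ℂ) ^ n * h0
  have hi : (q : ℂ) ^ ((i : ℤ) + 1) = q ^ (i + 1) := by exact_mod_cast zpow_natCast (q : ℂ) (i + 1)
  rw [zpow_sub₀ h2, zpow_natCast, hi, ← mul_div_assoc, h3, div_self (pow_ne_zero _ h2), sub_self]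

theorem ne_half_sub (h : QParam q a s x) (n i : ℕ) :
    1 - (q : ℂ) ^ (1 / 2 - (n + a)) * (q : ℂ) ^ i ≠ 0 := by
  intro h0
  refine h.one_sub_half_ne (n - (i + 1)) ?_
  have h1 := h.cpow_half_sub n
  have h2 := h.q_ne
  have h3 : x * s * (q : ℂ) ^ n = q ^ (i + 1) := by
    rw [pow_succ]
    linear_combination (q : ℂ) ^ i * h1 + x * s * (q : ℂ) ^ n * h0
  have hi : (q : ℂ) ^ ((i : ℤ) + 1) = q ^ (i + 1) := by exact_mod_cast zpow_natCast (q : ℂ) (i + 1)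
  rw [zpow_sub₀ h2, zpow_natCast, hi, ← mul_div_assoc, h3, div_self (pow_ne_zero _ h2), sub_self]

theorem ne_half (h : QParam q a s x) (i : ℕ) :
    1 - (q : ℂ) ^ (1 / 2 : ℂ) * (q : ℂ) ^ i ≠ 0 := by
  rw [← h.s_eq]
  exact one_sub_mul_pow_ne_zero h.norm_s_lt h.norm_q_lt i

theorem factorA_ne_zero (h : QParam q a s x) : factorA q a ≠ 0 := by
  have hx : 1 - (q : ℂ) ^ a ≠ 0 := by
    simpa [h.x_eq] using h.one_sub_x_ne 0
  have hx0 : (q : ℂ) ^ a ≠ 0 := h.x_eq ▸ h.x_ne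
  have g1 := qGamma_ne_zero h.q_pos h.q_lt (z := 1 - a) (by simpa using h.ne_one_sub 0)
  have g2 := qGamma_ne_zero h.q_pos h.q_lt h.ne_half_add
  have g3 := qGamma_ne_zero h.q_pos h.q_lt h.ne_three_mul_add_one
  have g4 := qGamma_ne_zero h.q_pos h.q_lt h.ne_half
  have g5 := qGamma_ne_zero h.q_pos h.q_lt (z := 1 / 2 - a) (by simpa using h.ne_half_sub 0)
  have g6 := qGamma_ne_zero h.q_pos h.q_lt h.ne_add_one
  have g7 := qGamma_ne_zero h.q_pos h.q_lt h.ne_two_mul_add_one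
  unfold factorA
  positivity

theorem kTerm_eq (h : QParam q a s x) (k : ℕ) : kTerm q a k = wzPhi s x 0 k / (1 - x) ^ 3 := by
  have hx : 1 - x ≠ 0 := by simpa using h.one_sub_x_ne 0
  have h1 : (q : ℂ) ^ ((k : ℂ) / 2) = s ^ k := by
    rw [h.s_eq, ← Complex.cpow_nat_mul]
    congr 1
    ring
  have h2 : (q : ℂ) ^ (3 * a + 2 * k + 1 / 2) = s * x ^ 3 * (q : ℂ) ^ (2 * k) := by
    rw [show 3 * a + 2 * k + 1 / 2 = 3 * a + ((2 * k : ℕ) : ℂ) + 1 / 2 by push_cast; ring,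
      Complex.cpow_add _ _ h.q_ne, Complex.cpow_add _ _ h.q_ne, h.cpow_three_mul, ← h.s_eq,
      Complex.cpow_natCast]
    ring
  have h3 : (q : ℂ) ^ ((k : ℂ) + 1 / 2) = s * (q : ℂ) ^ k := by
    rw [Complex.cpow_add _ _ h.q_ne, ← h.s_eq, Complex.cpow_natCast, mul_comm]
  have h4 : (q : ℂ) ^ (3 * a + k) = x ^ 3 * (q : ℂ) ^ k := by
    rw [Complex.cpow_add _ _ h.q_ne, h.cpow_three_mul, Complex.cpow_natCast]
  rw [kTerm, h1, h2, h3, h4, h.cpow_half_add, h.cpow_two_mul_add_one, h.cpow_three_mul_add_one,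
    ← h.s_eq, wzPhi, wzBase, h.sq_s, qPoch_succ s]
  simp only [mul_zero, zero_add, qPoch_zero, pow_zero, mul_one, one_pow, one_mul]
  generalize 1 - x ^ 3 * (q : ℂ) ^ k = A
  generalize 1 - s * (q : ℂ) ^ k = B
  generalize 1 - s * x ^ 3 * (q : ℂ) ^ (2 * k) = C
  generalize 1 - x = X at *
  field_simp

theorem nTerm_eq (h : QParam q a s x) (n : ℕ) : nTerm q a n = wzG0 s x n / (1 - x) ^ 3 := by
  have hs : 1 - s ≠ 0 := one_sub_ne_zero_of_norm_lt_one h.norm_s_lt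
  have h1 : (q : ℂ) ^ (a + n) = x * (q : ℂ) ^ n := by
    rw [Complex.cpow_add _ _ h.q_ne, ← h.x_eq, Complex.cpow_natCast]
  have h2 : (q : ℂ) ^ (2 * a + 2 * n) = (x * (q : ℂ) ^ n) ^ 2 := by
    rw [← h1, ← Complex.cpow_nat_mul]
    congr 1
    push_cast
    ring
  have h3 : (q : ℂ) ^ (2 * a + 2 * n + 1) = x ^ 2 * q * (q : ℂ) ^ (2 * n) := by
    rw [Complex.cpow_add _ _ h.q_ne, h2, Complex.cpow_one]
    ring
  rw [nTerm, h1, h2, h3, h.cpow_half_add, h.cpow_two_mul_add_one, h.cpow_three_mul_add_one,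
    h.cpow_add_one, ← h.s_eq, ← h.x_eq, wzG0, wzBase, h.sq_s]
  simp only [add_zero, pow_zero, zero_add, one_mul, show qPoch s q 1 = 1 - s by simp [qPoch]]
  rw [show x * (q : ℂ) ^ n + (x * (q : ℂ) ^ n) ^ 2 + 1 =
    1 + x * (q : ℂ) ^ n + (x * (q : ℂ) ^ n) ^ 2 by ring]
  generalize 1 + x * (q : ℂ) ^ n + (x * (q : ℂ) ^ n) ^ 2 = A
  generalize 1 - x ^ 2 * q * (q : ℂ) ^ (2 * n) = B
  generalize polyP q s (x * (q : ℂ) ^ n) = P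
  generalize 1 - x = X
  generalize 1 - s = S at *
  field_simp

end QParam

/-! ### The Dougall term and the boundary value in terms of the WZ pair -/

namespace QParam

variable {q : ℝ} {a s x : ℂ}

/-- Every argument is a base value plus an integer, so the functional equation of `Γ_q` reduces `F`
to finite products times Gamma values at `n = k = 0`, which `factorA` collects. -/
theorem wzF_eq (h : QParam q a s x) (n k : ℕ) :
    wzF q (n + a) k = factorA q a * (wzPhi s x n k / (1 - x) ^ 3) := by
  have hD := ofReal_one_sub_ne_zero h.q_lt
  have hq0 := h.q_ne
  have hx0 := h.x_ne
  have hs0 := h.s_ne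
  have hx : 1 - x ≠ 0 := by simpa using h.one_sub_x_ne 0
  have hxn : 1 - x * (q : ℂ) ^ n ≠ 0 := by exact_mod_cast h.one_sub_x_ne n
  have hcube : 1 - x ^ 3 * (q : ℂ) ^ (3 * n + k) ≠ 0 := by
    exact_mod_cast h.one_sub_cube_ne (3 * n + k : ℕ)
  have ga := qGamma_add_nat h.q_pos h.q_lt h.ne_half_add
  have gb := qGamma_add_nat h.q_pos h.q_lt h.ne_three_mul_add_one
  have gc := qGamma_add_nat h.q_pos h.q_lt h.ne_add_one
  have gd := qGamma_add_nat h.q_pos h.q_lt h.ne_two_mul_add_one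
  have ge := qGamma_add_nat h.q_pos h.q_lt h.ne_half (k + 1)
  have gf := qGamma_add_nat h.q_pos h.q_lt (h.ne_one_sub n) n
  have gg := qGamma_add_nat h.q_pos h.q_lt (h.ne_half_sub n) n
  have ha0 := qGamma_ne_zero h.q_pos h.q_lt h.ne_half_add
  have hc0 := qGamma_ne_zero h.q_pos h.q_lt h.ne_add_one
  have hd0 := qGamma_ne_zero h.q_pos h.q_lt h.ne_two_mul_add_one
  have he0 := qGamma_ne_zero h.q_pos h.q_lt h.ne_half
  have hf0 := qGamma_ne_zero h.q_pos h.q_lt (h.ne_one_sub n)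
  have hg0 := qGamma_ne_zero h.q_pos h.q_lt (h.ne_half_sub n)
  have hpf := qPoch_ne_zero (h.ne_one_sub n) n
  have hpg := qPoch_ne_zero (h.ne_half_sub n) n
  have hrev := qPoch_reverse_ratio hq0 (h.cpow_one_sub n) (h.cpow_half_sub n)
  -- arguments shifted down by one
  have g3 : qGamma q (3 * a + (3 * n + k : ℕ)) = qGamma q (3 * a + 1 + (3 * n + k : ℕ)) *
      (1 - q) / (1 - x ^ 3 * (q : ℂ) ^ (3 * n + k)) := by
    have e : (q : ℂ) ^ (3 * a + (3 * n + k : ℕ)) = x ^ 3 * (q : ℂ) ^ (3 * n + k) := by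
      rw [Complex.cpow_add _ _ hq0, h.cpow_three_mul, Complex.cpow_natCast]
    have := qGamma_add_nat h.q_pos h.q_lt (z := 3 * a + (3 * n + k : ℕ)) (fun i => by
      rw [e, mul_assoc, ← pow_add]
      exact_mod_cast h.one_sub_cube_ne (3 * n + k + i : ℕ)) 1
    rw [e] at this
    simp only [qPoch, Finset.prod_range_one, pow_zero, mul_one, pow_one, Nat.cast_one] at this
    rw [show 3 * a + 1 + ((3 * n + k : ℕ) : ℂ) = 3 * a + (3 * n + k : ℕ) + 1 by ring, this]
    field_simp
  have g1 : qGamma q (n + a) = qGamma q (a + 1 + n) * (1 - q) / (1 - x * (q : ℂ) ^ n) := by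
    have e : (q : ℂ) ^ (n + a) = x * (q : ℂ) ^ n := by
      rw [Complex.cpow_add _ _ hq0, ← h.x_eq, Complex.cpow_natCast, mul_comm]
    have := qGamma_add_nat h.q_pos h.q_lt (z := n + a) (fun i => by
      rw [e, mul_assoc, ← pow_add]
      exact_mod_cast h.one_sub_x_ne (n + i : ℕ)) 1
    rw [e] at this
    simp only [qPoch, Finset.prod_range_one, pow_zero, mul_one, pow_one, Nat.cast_one] at this
    rw [show a + 1 + (n : ℂ) = n + a + 1 by ring, this]
    field_simp
  have p1 : (q : ℂ) ^ ((2 * (n + a) + k) * (1 / 2 - (n + a) - (1 / 2 - (n + a)) -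
      (1 / 2 - (n + a)) - (n + a) + 1)) = x * (q : ℂ) ^ n * s ^ k := by
    rw [show (2 * (n + a) + k) * (1 / 2 - (n + a) - (1 / 2 - (n + a)) -
      (1 / 2 - (n + a)) - (n + a) + 1) = a + n + k * (1 / 2 : ℂ) by ring,
      Complex.cpow_add _ _ hq0, Complex.cpow_add _ _ hq0, ← h.x_eq, Complex.cpow_natCast,
      Complex.cpow_nat_mul, ← h.s_eq]
  have p2 : (q : ℂ) ^ (1 / 2 - (n + a) + 2 * (2 * (n + a) + k)) =
      s * x ^ 3 * (q : ℂ) ^ (3 * n + 2 * k) := by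
    rw [show 1 / 2 - (n + a) + 2 * (2 * (n + a) + k) = 1 / 2 + 3 * a + (3 * n + 2 * k : ℕ) by
      push_cast; ring, Complex.cpow_add _ _ hq0, Complex.cpow_add _ _ hq0, h.cpow_three_mul,
      ← h.s_eq, Complex.cpow_natCast]
  rw [wzF, dougall5F4q, p1, p2]
  rw [show 1 / 2 - (n + a) + (2 * (n + a) + k) = a + 1 / 2 + (n + k : ℕ) by push_cast; ring,
    show n + a + (2 * (n + a) + k) = 3 * a + (3 * n + k : ℕ) by push_cast; ring,
    show 1 / 2 - (n + a) - (1 / 2 - (n + a)) - (1 / 2 - (n + a)) - (n + a) + 1 = 1 / 2 by ring,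
    show 1 / 2 - (n + a) - (1 / 2 - (n + a)) - (1 / 2 - (n + a)) + 1 = a + 1 / 2 + n by ring,
    show 1 / 2 - (n + a) - (1 / 2 - (n + a)) - (n + a) + 1 = 1 - (n + a) by ring,
    show 1 / 2 - (n + a) - (1 / 2 - (n + a)) + (2 * (n + a) + k) + 1 =
      2 * a + 1 + (2 * n + k : ℕ) by push_cast; ring,
    show 1 / 2 - (n + a) - (n + a) + (2 * (n + a) + k) + 1 = 1 / 2 + (k + 1 : ℕ) by
      push_cast; ring,
    show 2 * (n + a) + k + 1 = 2 * a + 1 + (2 * n + k : ℕ) by push_cast; ring]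
  rw [show 1 - (n + a) + n = 1 - a by ring] at gf
  rw [show 1 / 2 - (n + a) + n = 1 / 2 - a by ring] at gg
  rw [g3, g1, ga, ga, gb, gc, gd, ge, factorA, gf, gg, h.cpow_half_add, h.cpow_add_one,
    h.cpow_two_mul_add_one, h.cpow_three_mul_add_one, ← h.s_eq, ← h.x_eq, wzPhi, wzBase, h.sq_s]
  have hY : qPoch x q n * (1 - x * (q : ℂ) ^ n) = (1 - x) * qPoch (x * q) q n := by
    rw [← qPoch_succ, qPoch_succ']
  have hpx := qPoch_ne_zero (a := x * q) (q := q)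
    (fun i => by rw [← h.cpow_add_one]; exact h.ne_add_one i) n
  have hpx2 := qPoch_ne_zero (a := x ^ 2 * q) (q := q)
    (fun i => by rw [← h.cpow_two_mul_add_one]; exact h.ne_two_mul_add_one i) (2 * n + k)
  have hps := qPoch_ne_zero (a := s) (q := q)
    (fun i => one_sub_mul_pow_ne_zero h.norm_s_lt h.norm_q_lt i) (k + 1)
  have hpxs := qPoch_ne_zero (a := x * s) (q := q)
    (fun i => by rw [← h.cpow_half_add]; exact h.ne_half_add i) n
  -- The reversed quotient enters squared and contributes `(s^n)^(-2)`, which cancels the `q^n`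
  -- coming from the power prefactor of `F`.
  have hsq : (s ^ n) ^ 2 = (q : ℂ) ^ n := by rw [← pow_mul, mul_comm, pow_mul, h.sq_s]
  have hsn : s ^ n ≠ 0 := pow_ne_zero _ hs0
  have hpx0 : qPoch x q n ≠ 0 := by
    intro h0
    rw [h0, zero_mul] at hY
    exact mul_ne_zero hx hpx hY.symm
  have hxq : qPoch (x * q) q n = qPoch x q n * (1 - x * (q : ℂ) ^ n) / (1 - x) := by
    rw [hY]; field_simp
  have hrev' : qPoch (q ^ (1 - (n + a) : ℂ)) q n =
      qPoch (q ^ (1 / 2 - (n + a) : ℂ)) q n * s ^ n * qPoch x q n / qPoch (x * s) q n := by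
    rw [hrev]; field_simp
  rw [hxq, hrev']
  clear g3 g1 ga gb gc gd ge gf gg p1 p2 hxq hrev' hrev hY hpf
  generalize 1 - (q : ℂ) = D at *
  generalize 1 - x * (q : ℂ) ^ n = X1 at *
  rw [← hsq]
  clear hsq
  generalize 1 - x = X at *
  generalize 1 - x ^ 3 * (q : ℂ) ^ (3 * n + k) = X3 at *
  generalize 1 - s * x ^ 3 * (q : ℂ) ^ (3 * n + 2 * k) = X4 at *
  generalize qPoch (q ^ (1 / 2 - (n + a) : ℂ)) q n = P1 at *
  generalize qPoch x q n = P2 at *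
  generalize qPoch (x * s) q n = P3 at *
  generalize qPoch (x * s) q (n + k) = P4 at *
  generalize qPoch (x ^ 2 * q) q (2 * n + k) = P5 at *
  generalize qPoch (x ^ 3 * q) q (3 * n + k) = P6 at *
  generalize qPoch s q (k + 1) = P7 at *
  generalize qGamma q (a + 1 / 2) = G1 at *
  generalize qGamma q (a + 1) = G2 at *
  generalize qGamma q (2 * a + 1) = G3 at *
  generalize qGamma q (3 * a + 1) = G4 at *
  generalize qGamma q (1 / 2) = G5 at *
  generalize qGamma q (1 / 2 - (n + a)) = G6 at *
  generalize qGamma q (1 - (n + a)) = G7 at *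
  generalize s ^ n = S at *
  generalize s ^ k = S' at *
  field_simp
  ring

theorem boundaryValue_eq (h : QParam q a s x) :
    boundaryValue q a = factorA q a *
      ((wzConst s x * ∑' k, s ^ k / qPoch s (s ^ 2) (k + 1)) / (1 - x) ^ 3) := by
  have hD := ofReal_one_sub_ne_zero h.q_lt
  have hq0 := h.q_ne
  have hx0 := h.x_ne
  have hx : 1 - x ≠ 0 := by simpa using h.one_sub_x_ne 0
  have hs1 : 1 - s ≠ 0 := one_sub_ne_zero_of_norm_lt_one h.norm_s_lt
  have hqq := qPochInf_ne_zero h.norm_q_lt (one_sub_mul_pow_ne_zero h.norm_q_lt h.norm_q_lt)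
  have g3 : qGamma q (3 / 2) = qGamma q (1 / 2) * (1 - s) / (1 - q) := by
    have := qGamma_add_nat h.q_pos h.q_lt h.ne_half 1
    simp only [qPoch, Finset.prod_range_one, pow_zero, mul_one, pow_one, Nat.cast_one] at this
    rw [show (3 / 2 : ℂ) = 1 / 2 + 1 by norm_num, this, h.s_eq]
  have g1 : qGamma q a = qGamma q (a + 1) * (1 - q) / (1 - x) := by
    have := qGamma_add_nat h.q_pos h.q_lt (z := a) (fun i => by
      rw [← h.x_eq]
      exact_mod_cast h.one_sub_x_ne i) 1
    rw [← h.x_eq] at this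
    simp only [qPoch, Finset.prod_range_one, pow_zero, mul_one, pow_one, Nat.cast_one] at this
    rw [this]
    field_simp
  have g4 := qGamma_ne_zero h.q_pos h.q_lt h.ne_half
  have g5 := qGamma_ne_zero h.q_pos h.q_lt (z := 1 / 2 - a) (by simpa using h.ne_half_sub 0)
  have i1 := qPochInf_ne_zero h.norm_q_lt h.ne_half_add
  have i2 := qPochInf_ne_zero h.norm_q_lt h.ne_add_one
  have i3 := qPochInf_ne_zero h.norm_q_lt h.ne_two_mul_add_one
  have i4 := qPochInf_ne_zero h.norm_q_lt h.ne_three_mul_add_one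
  have k0 : (1 - (q : ℂ)) ^ a ≠ 0 := by
    rw [Complex.cpow_def_of_ne_zero hD]
    exact Complex.exp_ne_zero _
  have k1 : (1 - (q : ℂ)) ^ (1 / 2 : ℂ) ≠ 0 := by
    rw [Complex.cpow_def_of_ne_zero hD]
    exact Complex.exp_ne_zero _
  have k2 : ((1 - (q : ℂ)) ^ (1 / 2 : ℂ)) ^ 2 = 1 - q := by
    rw [← Complex.cpow_nat_mul]
    norm_num
  have e1 : (1 - (q : ℂ)) ^ (1 - (a + 1 / 2)) = (1 - (q : ℂ)) ^ (1 / 2 : ℂ) / (1 - q) ^ a := by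
    rw [← Complex.cpow_sub _ _ hD]
    congr 1
    ring
  have e2 : (1 - (q : ℂ)) ^ (1 - (a + 1)) = 1 / (1 - (q : ℂ)) ^ a := by
    rw [show 1 - (a + 1) = -a by ring, Complex.cpow_neg, one_div]
  have e3 : (1 - (q : ℂ)) ^ (1 - (2 * a + 1)) = 1 / ((1 - (q : ℂ)) ^ a) ^ 2 := by
    rw [show 1 - (2 * a + 1) = -((2 : ℕ) * a) by push_cast; ring, Complex.cpow_neg,
      Complex.cpow_nat_mul, one_div]
  have e4 : (1 - (q : ℂ)) ^ (1 - (3 * a + 1)) = 1 / ((1 - (q : ℂ)) ^ a) ^ 3 := by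
    rw [show 1 - (3 * a + 1) = -((3 : ℕ) * a) by push_cast; ring, Complex.cpow_neg,
      Complex.cpow_nat_mul, one_div]
  rw [tsum_pow_div_qPoch h.norm_s_lt, boundaryValue, factorA, g3, g1, ← h.x_eq, ← h.s_eq]
  rw [qGamma.eq_def q (a + 1 / 2), qGamma.eq_def q (a + 1), qGamma.eq_def q (2 * a + 1),
    qGamma.eq_def q (3 * a + 1), e1, e2, e3, e4, wzConst, h.sq_s]
  rw [h.cpow_half_add] at i1 ⊢
  rw [h.cpow_add_one] at i2 ⊢
  rw [h.cpow_two_mul_add_one] at i3 ⊢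
  rw [h.cpow_three_mul_add_one] at i4 ⊢
  clear g3 g1 e1 e2 e3 e4
  have hD2 : (1 - s) * (1 + s) = 1 - q := by rw [← h.sq_s]; ring
  generalize (∑' r, altTerm s r) = T at *
  generalize qGamma q (1 / 2) = G5 at *
  generalize qGamma q (1 / 2 - a) = G6 at *
  generalize qGamma q (1 - a) = G7 at *
  generalize (1 - (q : ℂ)) ^ a = d at *
  generalize (1 - (q : ℂ)) ^ (1 / 2 : ℂ) = e at *
  have hs2 : 1 + s = (1 - q) / (1 - s) := by
    rw [← hD2]
    field_simp
  rw [hs2, ← k2]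
  clear hs2 hD2 k2
  generalize 1 - x = X at *
  generalize 1 - s = Y at *
  generalize qPochInf (q : ℂ) q = Q at *
  generalize qPochInf (x * s) (q : ℂ) = Q1 at *
  generalize qPochInf (x * q) (q : ℂ) = Q2 at *
  generalize qPochInf (x ^ 2 * q) (q : ℂ) = Q3 at *
  generalize qPochInf (x ^ 3 * q) (q : ℂ) = Q4 at *
  field_simp

end QParam

/-! ### The series identity at `a = 0` -/

theorem wzParam_one {s : ℂ} (h0 : s ≠ 0) (h1 : ‖s‖ < 1) : WZParam s 1 where
  s_ne := h0
  s_lt := h1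
  sq_ne i := by
    rw [one_pow, one_mul]
    exact one_sub_mul_pow_ne_zero (sq_norm_lt h1) (sq_norm_lt h1) i
  cube_ne i := by
    rw [one_pow, one_mul]
    exact one_sub_mul_pow_ne_zero (sq_norm_lt h1) (sq_norm_lt h1) i
  quad_ne := by norm_num

theorem wzPhi_one_zero (s : ℂ) (k : ℕ) : wzPhi s 1 0 k = 0 := by simp [wzPhi]

/-- At `x = 1` the polynomial `polyP` acquires the factor `(1 - s^(2n+1))^3`, which cancels half of
`(1 - s^(4n+2))^3` and leaves `(1 + s^(2n+1))^3`. -/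
theorem wzG0_one {s : ℂ} (h1 : ‖s‖ < 1) (n : ℕ) : wzG0 s 1 n = -qGuilleraTerm s n := by
  have hs : 1 - s ≠ 0 := one_sub_ne_zero_of_norm_lt_one h1
  have hB : 1 - s ^ (2 * n + 1) ≠ 0 := by
    have := one_sub_mul_pow_ne_zero h1 (sq_norm_lt h1) n
    rwa [show s * (s ^ 2) ^ n = s ^ (2 * n + 1) by ring] at this
  have hC : s ^ (2 * n + 1) + 1 ≠ 0 := by
    have : ‖-s ^ (2 * n + 1)‖ < 1 := by
      rw [norm_neg, norm_pow]
      exact pow_lt_one₀ (norm_nonneg _) h1 (by lia)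
    have := one_sub_ne_zero_of_norm_lt_one this
    rwa [sub_neg_eq_add, add_comm] at this
  rw [wzG0, wzBase, qGuilleraTerm]
  simp only [add_zero, pow_zero, zero_add, one_mul, one_pow,
    show qPoch s (s ^ 2) 1 = 1 - s by simp [qPoch]]
  rw [show 1 - s ^ 2 * (s ^ 2) ^ (2 * n) = (1 - s ^ (2 * n + 1)) * (s ^ (2 * n + 1) + 1) by ring,
    show 1 + (s ^ 2) ^ n + ((s ^ 2) ^ n) ^ 2 = s ^ (2 * n) + s ^ (4 * n) + 1 by ring]
  have hP : polyP (s ^ 2) s ((s ^ 2) ^ n) = -((1 - s ^ (2 * n + 1)) ^ 3 *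
      (3 * s ^ (2 * n + 1) - 4 * s ^ (4 * n + 1) + 2 * s ^ (4 * n + 2) - 4 * s ^ (6 * n + 1)
        - 4 * s ^ (6 * n + 2) + 2 * s ^ (8 * n + 1) - 4 * s ^ (8 * n + 2)
        + 3 * s ^ (10 * n + 2) + 3 * s ^ (12 * n + 3) + 3)) := by
    rw [polyP]
    ring
  rw [hP, ← pow_mul s 2 n]
  generalize 3 * s ^ (2 * n + 1) - 4 * s ^ (4 * n + 1) + 2 * s ^ (4 * n + 2) - 4 * s ^ (6 * n + 1)
        - 4 * s ^ (6 * n + 2) + 2 * s ^ (8 * n + 1) - 4 * s ^ (8 * n + 2)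
        + 3 * s ^ (10 * n + 2) + 3 * s ^ (12 * n + 3) + 3 = P
  generalize 1 - s ^ (2 * n + 1) = B at *
  generalize s ^ (2 * n + 1) + 1 = C at *
  generalize s ^ (2 * n) + s ^ (4 * n) + 1 = A at *
  generalize 1 - s = S at *
  field_simp

theorem sq_cpow_half {q : ℝ} (h0 : 0 < q) : ((q : ℂ) ^ 2) ^ (1 / 2 : ℂ) = q := by
  rw [one_div]
  exact Complex.sq_cpow_two_inv (by simpa using h0)

theorem qGamma_sq_half {q : ℝ} (h0 : 0 < q) :
    qGamma (q ^ 2) (1 / 2) ^ 2 = (1 - (q : ℂ) ^ 2) * qPochInf ((q : ℂ) ^ 2) ((q : ℂ) ^ 2) ^ 2 /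
      qPochInf (q : ℂ) ((q : ℂ) ^ 2) ^ 2 := by
  rw [qGamma, Complex.ofReal_pow, sq_cpow_half h0, div_pow, mul_pow, ← Complex.cpow_nat_mul]
  norm_num

/-- This is `hasSum_G0` at `x = 1` with `s` equal to `q`, so that the base is `q²`. The initial sum
over `k` vanishes and only the boundary limit contributes. -/
theorem hasSum_qGuilleraTerm {q : ℝ} (h0 : 0 < q) (h1 : q < 1) :
    HasSum (fun n : ℕ => qGuilleraTerm q n) (qGuilleraValue q) := by
  have hq0 : (q : ℂ) ≠ 0 := by exact_mod_cast h0.ne'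
  have hq := norm_ofReal_lt_one h0 h1
  have hq2 := sq_norm_lt hq
  have h := (wzParam_one hq0 hq).hasSum_G0
  simp only [wzPhi_one_zero, tsum_zero, zero_sub] at h
  have h2 := h.neg
  simp only [wzG0_one hq, neg_neg] at h2
  suffices e : qGuilleraValue q = wzConst (q : ℂ) 1 *
      ∑' k, (q : ℂ) ^ k / qPoch q ((q : ℂ) ^ 2) (k + 1) by
    rw [e]
    exact h2
  have hD := ofReal_one_sub_ne_zero h1
  have hE : 1 + (q : ℂ) ≠ 0 := by exact_mod_cast (by positivity : (1 + q) ≠ 0)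
  have i1 := qPochInf_ne_zero hq2 (one_sub_mul_pow_ne_zero hq2 hq2)
  have i2 := qPochInf_ne_zero hq2 (one_sub_mul_pow_ne_zero hq hq2)
  rw [qGuilleraValue, show qGamma (q ^ 2) (1 / 2) ^ 6 = (qGamma (q ^ 2) (1 / 2) ^ 2) ^ 3 by ring,
    qGamma_sq_half h0, tsum_pow_div_qPoch hq, wzConst,
    show 1 - (q : ℂ) ^ 2 = (1 - q) * (1 + q) by ring]
  simp only [one_pow, one_mul]
  generalize 1 - (q : ℂ) = D at *
  generalize 1 + (q : ℂ) = E at *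
  generalize (∑' r, altTerm (q : ℂ) r) = T at *
  field_simp

/-! ### The termwise limit -/

theorem tendsto_ofReal_one : Tendsto (fun q : ℝ => (q : ℂ)) (𝓝[<] 1) (𝓝 1) := by
  have : Tendsto (fun q : ℝ => (q : ℂ)) (𝓝 1) (𝓝 ((1 : ℝ) : ℂ)) :=
    Complex.continuous_ofReal.tendsto 1
  rw [Complex.ofReal_one] at this
  exact this.mono_left nhdsWithin_le_nhds

theorem tendsto_one_sub_pow_div (m : ℕ) :
    Tendsto (fun q : ℝ => (1 - (q : ℂ) ^ m) / (1 - q)) (𝓝[<] 1) (𝓝 m) := by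
  have h : Tendsto (fun q : ℝ => ∑ i ∈ Finset.range m, (q : ℂ) ^ i) (𝓝[<] 1)
      (𝓝 (∑ i ∈ Finset.range m, (1 : ℂ) ^ i)) :=
    tendsto_finsetSum _ fun i _ => tendsto_ofReal_one.pow i
  simp only [one_pow, Finset.sum_const, Finset.card_range, nsmul_eq_mul, mul_one] at h
  refine h.congr' ?_
  filter_upwards [self_mem_nhdsWithin] with q hq
  have hD := ofReal_one_sub_ne_zero hq
  rw [eq_div_iff hD, mul_comm, mul_neg_geom_sum]

theorem tendsto_qPoch_div (c m : ℕ) :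
    Tendsto (fun q : ℝ => qPoch ((q : ℂ) ^ c) ((q : ℂ) ^ 2) m / (1 - q) ^ m) (𝓝[<] 1)
      (𝓝 (∏ i ∈ Finset.range m, ((c + 2 * i : ℕ) : ℂ))) := by
  have h := tendsto_finsetProd (Finset.range m) fun i _ => tendsto_one_sub_pow_div (c + 2 * i)
  refine h.congr fun q => ?_
  rw [Finset.prod_div_distrib, Finset.prod_const, Finset.card_range, qPoch]
  congr 1
  exact Finset.prod_congr rfl fun i _ => by ring

/-- With `u = 1 - q^(2n)` and `v = 1 - q`, the expansion starts in degree two with `37 u² + 27 u v +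
6 v²`. As `u / v → 2n`, division by `v²` gives `2 (74 n² + 27 n + 3)`. -/
theorem qGuilleraPoly_eq (u v : ℂ) :
    3 * ((1 - u) * (1 - v)) - 4 * ((1 - u) ^ 2 * (1 - v)) + 2 * ((1 - u) ^ 2 * (1 - v) ^ 2)
      - 4 * ((1 - u) ^ 3 * (1 - v)) - 4 * ((1 - u) ^ 3 * (1 - v) ^ 2)
      + 2 * ((1 - u) ^ 4 * (1 - v)) - 4 * ((1 - u) ^ 4 * (1 - v) ^ 2)
      + 3 * ((1 - u) ^ 5 * (1 - v) ^ 2) + 3 * ((1 - u) ^ 6 * (1 - v) ^ 3) + 3 =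
    (37 - 123 * v + 131 * v ^ 2 - 45 * v ^ 3 - 74 * u + 204 * u * v - 190 * u * v ^ 2
        + 60 * u * v ^ 3 + 58 * u ^ 2 - 159 * u ^ 2 * v + 146 * u ^ 2 * v ^ 2
        - 45 * u ^ 2 * v ^ 3 - 21 * u ^ 3 + 60 * u ^ 3 * v - 57 * u ^ 3 * v ^ 2
        + 18 * u ^ 3 * v ^ 3 + 3 * u ^ 4 - 9 * u ^ 4 * v + 9 * u ^ 4 * v ^ 2
        - 3 * u ^ 4 * v ^ 3) * u ^ 2 +
      (27 - 45 * v + 18 * v ^ 2) * (u * v) + (6 - 3 * v) * v ^ 2 := by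
  ring

theorem tendsto_qGuilleraPoly (n : ℕ) :
    Tendsto (fun q : ℝ => (3 * (q : ℂ) ^ (2 * n + 1) - 4 * (q : ℂ) ^ (4 * n + 1)
      + 2 * (q : ℂ) ^ (4 * n + 2) - 4 * (q : ℂ) ^ (6 * n + 1) - 4 * (q : ℂ) ^ (6 * n + 2)
      + 2 * (q : ℂ) ^ (8 * n + 1) - 4 * (q : ℂ) ^ (8 * n + 2) + 3 * (q : ℂ) ^ (10 * n + 2)
      + 3 * (q : ℂ) ^ (12 * n + 3) + 3) / (1 - q) ^ 2) (𝓝[<] 1)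
      (𝓝 (2 * (74 * (n : ℂ) ^ 2 + 27 * n + 3))) := by
  have hv : Tendsto (fun q : ℝ => 1 - (q : ℂ)) (𝓝[<] 1) (𝓝 0) := by
    simpa using tendsto_ofReal_one.const_sub 1
  have hu : Tendsto (fun q : ℝ => 1 - (q : ℂ) ^ (2 * n)) (𝓝[<] 1) (𝓝 0) := by
    simpa using (tendsto_ofReal_one.pow (2 * n)).const_sub 1
  have huv := hu.prodMk_nhds hv
  have hA : Tendsto (fun p : ℂ × ℂ => 37 - 123 * p.2 + 131 * p.2 ^ 2 - 45 * p.2 ^ 3 - 74 * p.1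
      + 204 * p.1 * p.2 - 190 * p.1 * p.2 ^ 2
        + 60 * p.1 * p.2 ^ 3 + 58 * p.1 ^ 2 - 159 * p.1 ^ 2 * p.2 + 146 * p.1 ^ 2 * p.2 ^ 2
        - 45 * p.1 ^ 2 * p.2 ^ 3 - 21 * p.1 ^ 3 + 60 * p.1 ^ 3 * p.2 - 57 * p.1 ^ 3 * p.2 ^ 2
        + 18 * p.1 ^ 3 * p.2 ^ 3 + 3 * p.1 ^ 4 - 9 * p.1 ^ 4 * p.2 + 9 * p.1 ^ 4 * p.2 ^ 2
        - 3 * p.1 ^ 4 * p.2 ^ 3) (𝓝 (0, 0)) (𝓝 37) := by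
    refine Continuous.tendsto' (by fun_prop) _ _ (by norm_num)
  have hB : Tendsto (fun p : ℂ × ℂ => 27 - 45 * p.2 + 18 * p.2 ^ 2) (𝓝 (0, 0)) (𝓝 27) :=
    Continuous.tendsto' (by fun_prop) _ _ (by norm_num)
  have hC : Tendsto (fun p : ℂ × ℂ => 6 - 3 * p.2) (𝓝 (0, 0)) (𝓝 6) :=
    Continuous.tendsto' (by fun_prop) _ _ (by norm_num)
  have hr := tendsto_one_sub_pow_div (2 * n)
  have h := (((hA.comp huv).mul (hr.pow 2)).add ((hB.comp huv).mul hr)).add (hC.comp huv)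
  have e : (37 * ((2 * n : ℕ) : ℂ) ^ 2 + 27 * ((2 * n : ℕ) : ℂ) + 6) =
      2 * (74 * (n : ℂ) ^ 2 + 27 * n + 3) := by
    push_cast
    ring
  rw [e] at h
  refine h.congr' ?_
  filter_upwards [self_mem_nhdsWithin] with q hq
  have hD := ofReal_one_sub_ne_zero hq
  have key := qGuilleraPoly_eq (1 - (q : ℂ) ^ (2 * n)) (1 - q)
  simp only [sub_sub_cancel] at key
  simp only [Function.comp]
  rw [show 3 * (q : ℂ) ^ (2 * n + 1) - 4 * (q : ℂ) ^ (4 * n + 1)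
      + 2 * (q : ℂ) ^ (4 * n + 2) - 4 * (q : ℂ) ^ (6 * n + 1) - 4 * (q : ℂ) ^ (6 * n + 2)
      + 2 * (q : ℂ) ^ (8 * n + 1) - 4 * (q : ℂ) ^ (8 * n + 2) + 3 * (q : ℂ) ^ (10 * n + 2)
      + 3 * (q : ℂ) ^ (12 * n + 3) + 3 = _ from Eq.trans (by ring) key]
  generalize 1 - (q : ℂ) ^ (2 * n) = u at *
  generalize 1 - (q : ℂ) = v at *
  field_simp

theorem prod_ratio_eq (n : ℕ) :
    (∏ i ∈ Finset.range (3 * n), ((2 + 2 * i : ℕ) : ℂ)) *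
        (∏ i ∈ Finset.range n, ((1 + 2 * i : ℕ) : ℂ)) ^ 6 /
      ((∏ i ∈ Finset.range n, ((2 + 2 * i : ℕ) : ℂ)) ^ 3 *
        (∏ i ∈ Finset.range (2 * n), ((2 + 2 * i : ℕ) : ℂ)) ^ 3) =
    ((3 : ℂ) ^ 3 / 4 ^ 3) ^ n * (rising (1 / 2) n ^ 3 * rising (1 / 3) n * rising (2 / 3) n) /
      rising 1 n ^ 5 := by
  induction n with
  | zero => simp [rising]
  | succ n ih =>
    have hE : ∀ m, ∏ i ∈ Finset.range m, ((2 + 2 * i : ℕ) : ℂ) ≠ 0 := fun m =>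
      Finset.prod_ne_zero_iff.2 fun i _ => by
        exact_mod_cast (by lia : 2 + 2 * i ≠ 0)
    have h1 := hE n
    have h2 := hE (2 * n)
    have hR : rising 1 n ≠ 0 := Finset.prod_ne_zero_iff.2 fun i _ => by
      exact_mod_cast (by lia : 1 + i ≠ 0)
    simp only [rising] at hR ih ⊢
    rw [show 3 * (n + 1) = 3 * n + 1 + 1 + 1 by ring, show 2 * (n + 1) = 2 * n + 1 + 1 by ring]
    simp only [Finset.prod_range_succ]
    push_cast at *
    rw [div_eq_div_iff (by positivity) (by positivity)] at ih
    generalize ∏ i ∈ Finset.range (3 * n), (2 + 2 * (i : ℂ)) = E3 at *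
    generalize ∏ i ∈ Finset.range (2 * n), (2 + 2 * (i : ℂ)) = E2 at *
    generalize ∏ i ∈ Finset.range n, (2 + 2 * (i : ℂ)) = E1 at *
    generalize ∏ i ∈ Finset.range n, (1 + 2 * (i : ℂ)) = O at *
    generalize ∏ i ∈ Finset.range n, (1 / 2 + (i : ℂ)) = R1 at *
    generalize ∏ i ∈ Finset.range n, (1 / 3 + (i : ℂ)) = R2 at *
    generalize ∏ i ∈ Finset.range n, (2 / 3 + (i : ℂ)) = R3 at *
    generalize ∏ i ∈ Finset.range n, (1 + (i : ℂ)) = R0 at *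
    rw [div_eq_div_iff]
    · rw [pow_succ]
      linear_combination ih * (2 + 2 * (3 * (n : ℂ))) * (2 + 2 * (3 * n + 1)) *
        (2 + 2 * (3 * n + 1 + 1)) * (1 + 2 * n) ^ 6 * (1 + n) ^ 5
    · have h3 : 2 + 2 * (n : ℂ) ≠ 0 := by exact_mod_cast (by lia : 2 + 2 * n ≠ 0)
      have h4 : 2 + 2 * (2 * (n : ℂ)) ≠ 0 := by exact_mod_cast (by lia : 2 + 2 * (2 * n) ≠ 0)
      have h5 : 2 + 2 * (2 * (n : ℂ) + 1) ≠ 0 := by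
        exact_mod_cast (by lia : 2 + 2 * (2 * n + 1) ≠ 0)
      positivity
    · have h3 : 1 + (n : ℂ) ≠ 0 := by exact_mod_cast (by lia : 1 + n ≠ 0)
      positivity

theorem tendsto_qGuilleraTerm (n : ℕ) :
    Tendsto (fun q : ℝ => qGuilleraTerm q n / (1 - (q : ℂ)) ^ 2) (𝓝[<] 1)
      (𝓝 (1 / 12 * guilleraTerm n)) := by
  have h1 := tendsto_ofReal_one
  have hE := fun m => tendsto_qPoch_div 2 m
  have hO := tendsto_qPoch_div 1 n
  simp only [pow_one] at hO
  have hne : ∀ m, ∏ i ∈ Finset.range m, ((2 + 2 * i : ℕ) : ℂ) ≠ 0 := fun m =>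
    Finset.prod_ne_zero_iff.2 fun i _ => by
      exact_mod_cast (by lia : 2 + 2 * i ≠ 0)
  have hden : Tendsto (fun q : ℝ => ((q : ℂ) ^ (2 * n) + (q : ℂ) ^ (4 * n) + 1) *
      ((q : ℂ) ^ (2 * n + 1) + 1) ^ 3) (𝓝[<] 1) (𝓝 24) := by
    have := (((h1.pow (2 * n)).add (h1.pow (4 * n))).add_const 1).mul
      (((h1.pow (2 * n + 1)).add_const 1).pow 3)
    simp only [one_pow] at this
    norm_num at this
    exact this
  have h := (((h1.pow (2 * n)).mul (tendsto_qGuilleraPoly n)).div hden (by norm_num)).mul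
    (((hE (3 * n)).mul (hO.pow 6)).div (((hE n).pow 3).mul ((hE (2 * n)).pow 3))
      (mul_ne_zero (pow_ne_zero _ (hne _)) (pow_ne_zero _ (hne _))))
  rw [prod_ratio_eq] at h
  have e : (1 : ℂ) ^ (2 * n) * (2 * (74 * (n : ℂ) ^ 2 + 27 * n + 3)) / 24 *
      (((3 : ℂ) ^ 3 / 4 ^ 3) ^ n * (rising (1 / 2) n ^ 3 * rising (1 / 3) n * rising (2 / 3) n) /
      rising 1 n ^ 5) = 1 / 12 * guilleraTerm n := by
    rw [guilleraTerm, one_pow]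
    ring
  rw [e] at h
  refine h.congr' ?_
  filter_upwards [self_mem_nhdsWithin] with q hq
  have hD := ofReal_one_sub_ne_zero hq
  rw [qGuilleraTerm]
  simp only [Pi.div_apply]
  generalize 3 * (q : ℂ) ^ (2 * n + 1) - 4 * (q : ℂ) ^ (4 * n + 1)
      + 2 * (q : ℂ) ^ (4 * n + 2) - 4 * (q : ℂ) ^ (6 * n + 1) - 4 * (q : ℂ) ^ (6 * n + 2)
      + 2 * (q : ℂ) ^ (8 * n + 1) - 4 * (q : ℂ) ^ (8 * n + 2) + 3 * (q : ℂ) ^ (10 * n + 2)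
      + 3 * (q : ℂ) ^ (12 * n + 3) + 3 = P
  generalize (q : ℂ) ^ (2 * n) + (q : ℂ) ^ (4 * n) + 1 = A
  generalize (q : ℂ) ^ (2 * n + 1) + 1 = B
  generalize 1 - (q : ℂ) = D at *
  have hDn : ∀ m, D ^ m ≠ 0 := fun m => pow_ne_zero _ hD
  rw [show D ^ (3 * n) = (D ^ n) ^ 3 by ring, show D ^ (2 * n) = (D ^ n) ^ 2 by ring]
  have := hDn n
  generalize D ^ n = d at *
  field_simp

/-! ### The alternating series as a real series -/

/-- The absolute value of the summand of the alternating series. -/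
def altAbs (p : ℝ) (k : ℕ) : ℝ :=
  p ^ (3 * k * (k + 1)) * ((1 + p ^ (1 + 2 * k)) / (1 + p)) /
    ∑ j ∈ Finset.range (1 + 2 * k), p ^ j

theorem geomSum_pos {p : ℝ} (h0 : 0 < p) (k : ℕ) :
    0 < ∑ j ∈ Finset.range (1 + 2 * k), p ^ j :=
  Finset.sum_pos (fun _ _ => pow_pos h0 _) ⟨0, by simp⟩

theorem altTerm_ofReal {p : ℝ} (h0 : 0 < p) (h1 : p < 1) (k : ℕ) :
    altTerm p k = (((-1) ^ k * altAbs p k : ℝ) : ℂ) := by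
  have h : (1 - p) / (1 - p ^ (1 + 2 * k)) = (∑ j ∈ Finset.range (1 + 2 * k), p ^ j)⁻¹ := by
    rw [← mul_neg_geom_sum p (1 + 2 * k)]
    have h2 := (geomSum_pos h0 k).ne'
    have h3 : 1 - p ≠ 0 := (sub_pos.2 h1).ne'
    field_simp
  rw [altAbs, div_eq_mul_inv _ (∑ j ∈ Finset.range (1 + 2 * k), p ^ j), ← h, altTerm]
  push_cast
  ring

/-- With `(1 - p) / (1 - p^(1+2k))` written as the inverse of a geometric sum, both monotonicity and
the value at `p = 1` are visible. -/
theorem altAbs_antitone {p : ℝ} (h0 : 0 < p) (h1 : p < 1) : Antitone (altAbs p) := by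
  refine antitone_nat_of_succ_le fun k => ?_
  have h2 := geomSum_pos h0 k
  refine div_le_div₀ (by positivity) ?_ h2 ?_
  · refine mul_le_mul (pow_le_pow_of_le_one h0.le h1.le (by nlinarith)) ?_ (by positivity)
      (by positivity)
    gcongr ?_ / _
    have := pow_le_pow_of_le_one h0.le h1.le (show 1 + 2 * k ≤ 1 + 2 * (k + 1) by lia)
    linarith
  · exact Finset.sum_le_sum_of_subset_of_nonneg (Finset.range_mono (by lia))
      fun _ _ _ => by positivity

theorem altAbs_le {p : ℝ} (h0 : 0 < p) (h1 : p < 1) (k : ℕ) :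
    altAbs p k ≤ 1 / (1 + 2 * k) := by
  have h2 := geomSum_pos h0 k
  have h3 : (1 + 2 * k : ℝ) * p ^ (2 * k) ≤ ∑ j ∈ Finset.range (1 + 2 * k), p ^ j := by
    have := Finset.card_nsmul_le_sum (Finset.range (1 + 2 * k)) (fun j => p ^ j) (p ^ (2 * k))
      fun j hj => pow_le_pow_of_le_one h0.le h1.le (by
        have := Finset.mem_range.1 hj
        lia)
    simpa using this
  rw [altAbs, div_le_div_iff₀ h2 (by positivity), one_mul]
  refine le_trans ?_ h3
  rw [mul_comm]
  refine mul_le_mul_of_nonneg_left ?_ (by positivity)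
  have h4 : (1 + p ^ (1 + 2 * k)) / (1 + p) ≤ 1 := by
    rw [div_le_one (by positivity)]
    have := pow_le_pow_of_le_one h0.le h1.le (show 1 ≤ 1 + 2 * k by lia)
    linarith
  calc p ^ (3 * k * (k + 1)) * ((1 + p ^ (1 + 2 * k)) / (1 + p)) ≤ p ^ (2 * k) * 1 :=
        mul_le_mul (pow_le_pow_of_le_one h0.le h1.le (by nlinarith)) h4 (by positivity)
          (by positivity)
    _ = p ^ (2 * k) := mul_one _

theorem summable_altAbs {p : ℝ} (h0 : 0 < p) (h1 : p < 1) : Summable (altAbs p) := by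
  have h := (summable_altTerm (norm_ofReal_lt_one h0 h1)).norm
  refine h.congr fun k => ?_
  have hn : 0 ≤ altAbs p k :=
    div_nonneg (by positivity) (geomSum_pos h0 k).le
  rw [altTerm_ofReal h0 h1, Complex.norm_real, norm_mul, norm_pow, norm_neg, norm_one, one_pow,
    one_mul, Real.norm_of_nonneg hn]

theorem tsum_altTerm_ofReal {p : ℝ} (h0 : 0 < p) (h1 : p < 1) :
    ∑' k, altTerm p k = ((∑' k, (-1) ^ k * altAbs p k : ℝ) : ℂ) := by
  rw [Complex.ofReal_tsum]
  exact tsum_congr (altTerm_ofReal h0 h1)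

/-- The first two terms of the alternating series bound the sum below by `1 - 1/3 > 0`. -/
theorem tsum_altTerm_ne_zero {p : ℝ} (h0 : 0 < p) (h1 : p < 1) : ∑' k, altTerm p k ≠ 0 := by
  rw [tsum_altTerm_ofReal h0 h1, Complex.ofReal_ne_zero]
  have h := (altAbs_antitone h0 h1).alternating_series_le_tendsto
    (summable_altAbs h0 h1).tendsto_alternating_series_tsum 1
  have e0 : altAbs p 0 = 1 := by
    have : 1 + p ≠ 0 := by positivity
    simp [altAbs, this]
  have e1 := altAbs_le h0 h1 1
  norm_num [Finset.sum_range_succ, e0] at h e1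
  intro h2
  rw [h2] at h
  linarith

theorem tendsto_altAbs_one (k : ℕ) :
    Tendsto (fun p => altAbs p k) (𝓝[<] 1) (𝓝 (1 / (1 + 2 * k))) := by
  have h : Tendsto (fun p : ℝ => p) (𝓝[<] 1) (𝓝 1) := tendsto_id.mono_left nhdsWithin_le_nhds
  have h2 : Tendsto (fun p : ℝ => ∑ j ∈ Finset.range (1 + 2 * k), p ^ j) (𝓝[<] 1)
      (𝓝 (∑ j ∈ Finset.range (1 + 2 * k), 1 ^ j)) := tendsto_finsetSum _ fun i _ => h.pow i
  simp only [one_pow, Finset.sum_const, Finset.card_range, nsmul_eq_mul, mul_one] at h2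
  have h3 := ((h.pow (3 * k * (k + 1))).mul (((h.pow (1 + 2 * k)).const_add 1).div
    (h.const_add 1) (by norm_num))).div h2 (by positivity)
  convert h3 using 2
  · rfl
  · push_cast
    norm_num

/-- The bound `1 / (1 + 2k)` is not summable, so dominated convergence is unavailable. The Leibniz
error estimate bounds the tails uniformly in `p` instead, and uniform convergence permits exchanging
the limits. -/
theorem tendsto_tsum_altAbs :
    Tendsto (fun p => ∑' k, (-1) ^ k * altAbs p k) (𝓝[<] 1) (𝓝 (Real.pi / 4)) := by
  have hU : TendstoUniformlyOnFilter
      (fun (N : ℕ) (p : ℝ) => ∑ k ∈ Finset.range N, (-1) ^ k * altAbs p k)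
      (fun p => ∑' k, (-1) ^ k * altAbs p k) atTop (𝓝[<] 1) := by
    rw [Metric.tendstoUniformlyOnFilter_iff]
    intro ε hε
    have h1 : ∀ᶠ N : ℕ in atTop, 1 / (1 + 2 * (N : ℝ)) < ε := by
      obtain ⟨M, hM⟩ := exists_nat_one_div_lt hε
      filter_upwards [eventually_ge_atTop M] with N hN
      refine lt_of_le_of_lt ?_ hM
      have : (M : ℝ) ≤ N := by exact_mod_cast hN
      have : (0 : ℝ) ≤ N := N.cast_nonneg
      exact one_div_le_one_div_of_le (by positivity) (by linarith)
    have h2 : ∀ᶠ p : ℝ in 𝓝[<] 1, 0 < p ∧ p < 1 :=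
      Ioo_mem_nhdsLT (by norm_num)
    filter_upwards [h1.prod_mk h2] with x hx
    rw [Real.dist_eq]
    exact (alternating_series_error_bound _ (altAbs_antitone hx.2.1 hx.2.2)
      (summable_altAbs hx.2.1 hx.2.2) x.1).trans_lt ((altAbs_le hx.2.1 hx.2.2 x.1).trans_lt hx.1)
  refine hU.tendsto_of_eventually_tendsto
    (L := fun N => ∑ k ∈ Finset.range N, (-1) ^ k * (1 / (1 + 2 * (k : ℝ))))
    (Eventually.of_forall fun N => tendsto_finsetSum _ fun k _ =>
      (tendsto_altAbs_one k).const_mul _) ?_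
  refine Real.tendsto_sum_pi_div_four.congr fun N => Finset.sum_congr rfl fun k _ => ?_
  rw [mul_one_div, add_comm]

/-! ### The `q`-Wallis product -/

/-- The factors of the `q`-Wallis product are `1 + wallisTerm q i`. -/
def wallisTerm (q : ℝ) (i : ℕ) : ℝ :=
  q ^ (2 * i + 1) / ((∑ j ∈ Finset.range (1 + 2 * i), q ^ j) *
    ∑ j ∈ Finset.range (1 + 2 * (i + 1)), q ^ j)

/-- The arithmetic-geometric mean inequality: the outer terms `1` and `q^(2i+2)` add up to at least
`2 q^(i+1)`. It makes the bound on `wallisTerm` uniform in `q`. -/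
theorem mul_pow_le_geomSum {q : ℝ} (h0 : 0 < q) (i : ℕ) :
    (1 + 2 * i : ℝ) * q ^ i ≤ ∑ j ∈ Finset.range (1 + 2 * i), q ^ j := by
  induction i with
  | zero => simp
  | succ i ih =>
    have e : ∑ j ∈ Finset.range (1 + 2 * (i + 1)), q ^ j =
        1 + q * ∑ j ∈ Finset.range (1 + 2 * i), q ^ j + q ^ (2 * i + 2) := by
      rw [show 1 + 2 * (i + 1) = 1 + 2 * i + 1 + 1 by ring, Finset.sum_range_succ,
        Finset.sum_range_succ', Finset.mul_sum]
      simp only [pow_succ, pow_zero, mul_comm q]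
      ring
    rw [e]
    push_cast
    have := mul_le_mul_of_nonneg_left ih h0.le
    have h2 : q ^ (2 * i + 2) = (q ^ (i + 1)) ^ 2 := by ring
    have h3 : q * ((1 + 2 * (i : ℝ)) * q ^ i) = (1 + 2 * i) * q ^ (i + 1) := by ring
    rw [h2]
    nlinarith [sq_nonneg (1 - q ^ (i + 1))]

theorem wallisTerm_nonneg {q : ℝ} (h0 : 0 < q) (i : ℕ) : 0 ≤ wallisTerm q i :=
  div_nonneg (by positivity) (mul_nonneg (geomSum_pos h0 i).le (geomSum_pos h0 (i + 1)).le)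

theorem wallisTerm_le {q : ℝ} (h0 : 0 < q) (i : ℕ) :
    wallisTerm q i ≤ 1 / ((1 + 2 * i) * (1 + 2 * (i + 1))) := by
  rw [wallisTerm, div_le_div_iff₀ (mul_pos (geomSum_pos h0 i) (geomSum_pos h0 (i + 1)))
    (by positivity)]
  have := mul_le_mul (mul_pow_le_geomSum h0 i) (mul_pow_le_geomSum h0 (i + 1)) (by positivity)
    (geomSum_pos h0 i).le
  push_cast at this
  refine le_trans (le_of_eq ?_) (this.trans_eq (one_mul _).symm)
  ring

theorem summable_wallis_bound :
    Summable fun i : ℕ => 1 / ((1 + 2 * (i : ℝ)) * (1 + 2 * (i + 1))) := by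
  have h := (summable_nat_add_iff 1).2 (Real.summable_one_div_nat_pow.2 one_lt_two)
  refine Summable.of_nonneg_of_le (fun i => by positivity) (fun i => ?_) h
  push_cast
  have : (0 : ℝ) ≤ i := i.cast_nonneg
  exact one_div_le_one_div_of_le (by positivity) (by nlinarith)

/-- Rests on `(1 - q^(2i+2))² - (1 - q^(2i+1)) (1 - q^(2i+3)) = q^(2i+1) (1 - q)²`. -/
theorem one_add_wallisTerm {q : ℝ} (h0 : 0 < q) (h1 : q < 1) (i : ℕ) :
    1 + wallisTerm q i = (1 - q ^ 2 * (q ^ 2) ^ i) ^ 2 /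
      ((1 - q * (q ^ 2) ^ i) * (1 - q ^ 3 * (q ^ 2) ^ i)) := by
  have e1 := mul_neg_geom_sum q (1 + 2 * i)
  have e2 := mul_neg_geom_sum q (1 + 2 * (i + 1))
  have h2 := (geomSum_pos h0 i).ne'
  have h3 := (geomSum_pos h0 (i + 1)).ne'
  have h4 : 1 - q ≠ 0 := (sub_pos.2 h1).ne'
  rw [wallisTerm, show q * (q ^ 2) ^ i = q ^ (1 + 2 * i) by ring,
    show q ^ 3 * (q ^ 2) ^ i = q ^ (1 + 2 * (i + 1)) by ring, ← e1, ← e2]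
  generalize ∑ j ∈ Finset.range (1 + 2 * i), q ^ j = S at *
  generalize ∑ j ∈ Finset.range (1 + 2 * (i + 1)), q ^ j = T at *
  field_simp
  rw [show (S * T + q ^ (2 * i + 1)) * (1 - q) ^ 2 =
    ((1 - q) * S) * ((1 - q) * T) + (1 - q) ^ 2 * q ^ (2 * i + 1) by ring, e1, e2]
  ring

theorem tprod_wallis {q : ℝ} (h0 : 0 < q) (h1 : q < 1) :
    qGamma (q ^ 2) (1 / 2) ^ 2 = (1 + (q : ℂ)) * ((∏' i, (1 + wallisTerm q i) : ℝ) : ℂ) := by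
  have hq := norm_ofReal_lt_one h0 h1
  have hq2 := sq_norm_lt hq
  have hD := ofReal_one_sub_ne_zero h1
  have hn3 : ∀ i : ℕ, 1 - (q : ℂ) ^ 3 * ((q : ℂ) ^ 2) ^ i ≠ 0 := fun i =>
    one_sub_mul_pow_ne_zero (by
      rw [norm_pow]
      exact pow_lt_one₀ (norm_nonneg _) hq (by norm_num)) hq2 i
  have hn1 := one_sub_mul_pow_ne_zero hq hq2
  have i1 := qPochInf_ne_zero hq2 hn1
  have i3 := qPochInf_ne_zero hq2 hn3
  have hm : Multipliable fun i => 1 + wallisTerm q i := by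
    refine multipliable_one_add_of_summable ?_
    refine Summable.of_nonneg_of_le (fun i => norm_nonneg _) (fun i => ?_) summable_wallis_bound
    rw [Real.norm_of_nonneg (wallisTerm_nonneg h0 i)]
    exact wallisTerm_le h0 i
  have h2 := (Complex.continuous_ofReal.tendsto _).comp hm.hasProd.tendsto_prod_nat
  have h3 := ((tendsto_qPoch ((q : ℂ) ^ 2) hq2).pow 2).div
    ((tendsto_qPoch (q : ℂ) hq2).mul (tendsto_qPoch ((q : ℂ) ^ 3) hq2)) (mul_ne_zero i1 i3)
  have h4 : ((∏' i, (1 + wallisTerm q i) : ℝ) : ℂ) = qPochInf ((q : ℂ) ^ 2) ((q : ℂ) ^ 2) ^ 2 /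
      (qPochInf (q : ℂ) ((q : ℂ) ^ 2) * qPochInf ((q : ℂ) ^ 3) ((q : ℂ) ^ 2)) := by
    refine tendsto_nhds_unique h2 (h3.congr fun n => ?_)
    simp only [Function.comp, Pi.div_apply]
    rw [Complex.ofReal_prod, qPoch, qPoch, qPoch, ← Finset.prod_pow, ← Finset.prod_mul_distrib,
      ← Finset.prod_div_distrib]
    refine Finset.prod_congr rfl fun i _ => ?_
    rw [one_add_wallisTerm h0 h1]
    push_cast
    rfl
  -- Splitting off the first factor of `(q; q²)_∞` turns the prefactor `1 - q²` into `1 + q`.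
  have h5 := qPochInf_eq_mul (q : ℂ) hq2 1
  simp only [qPoch, Finset.prod_range_one, pow_zero, mul_one, pow_one] at h5
  rw [show (q : ℂ) * (q : ℂ) ^ 2 = (q : ℂ) ^ 3 by ring] at h5
  rw [h4, qGamma_sq_half h0, h5]
  rw [show 1 - (q : ℂ) ^ 2 = (1 - q) * (1 + q) by ring]
  generalize 1 - (q : ℂ) = D at *
  field_simp

theorem tendsto_wallisTerm (i : ℕ) : Tendsto (fun q => wallisTerm q i) (𝓝[<] 1)
    (𝓝 (1 / ((1 + 2 * i) * (1 + 2 * (i + 1))))) := by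
  have h : Tendsto (fun p : ℝ => p) (𝓝[<] 1) (𝓝 1) := tendsto_id.mono_left nhdsWithin_le_nhds
  have h2 : ∀ k : ℕ, Tendsto (fun p : ℝ => ∑ j ∈ Finset.range (1 + 2 * k), p ^ j) (𝓝[<] 1)
      (𝓝 ((1 + 2 * k : ℕ) : ℝ)) := fun k => by
    have : Tendsto (fun p : ℝ => ∑ j ∈ Finset.range (1 + 2 * k), p ^ j) (𝓝[<] 1)
      (𝓝 (∑ j ∈ Finset.range (1 + 2 * k), 1 ^ j)) := tendsto_finsetSum _ fun i _ => h.pow i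
    simpa only [one_pow, Finset.sum_const, Finset.card_range, nsmul_eq_mul, mul_one] using this
  have h3 := (h.pow (2 * i + 1)).div ((h2 i).mul (h2 (i + 1))) (by positivity)
  convert h3 using 2
  · rfl
  · push_cast
    rw [one_pow]

theorem tprod_wallis_one :
    ∏' i : ℕ, (1 + 1 / ((1 + 2 * (i : ℝ)) * (1 + 2 * (i + 1)))) = Real.pi / 2 := by
  have hm : Multipliable fun i : ℕ => 1 + 1 / ((1 + 2 * (i : ℝ)) * (1 + 2 * (i + 1))) := by
    refine multipliable_one_add_of_summable ?_
    exact summable_wallis_bound.norm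
  refine tendsto_nhds_unique hm.hasProd.tendsto_prod_nat
    (Real.tendsto_prod_pi_div_two.congr fun n => Finset.prod_congr rfl fun i _ => ?_)
  field_simp
  ring

theorem tendsto_qGamma_half_sq :
    Tendsto (fun q : ℝ => qGamma (q ^ 2) (1 / 2) ^ 2) (𝓝[<] 1) (𝓝 (Real.pi : ℂ)) := by
  have h2 : ∀ᶠ p : ℝ in 𝓝[<] 1, 0 < p ∧ p < 1 := Ioo_mem_nhdsLT (by norm_num)
  have h := tendsto_tprod_one_add_of_dominated_convergence summable_wallis_bound
    tendsto_wallisTerm (h2.mono fun q hq i => by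
      rw [Real.norm_of_nonneg (wallisTerm_nonneg hq.1 i)]
      exact wallisTerm_le hq.1 i)
  rw [tprod_wallis_one] at h
  have h3 := (tendsto_ofReal_one.const_add 1).mul ((Complex.continuous_ofReal.tendsto _).comp h)
  have e : (1 + 1) * ((Real.pi / 2 : ℝ) : ℂ) = Real.pi := by
    push_cast
    ring
  rw [e] at h3
  refine h3.congr' ?_
  filter_upwards [h2] with q hq
  exact (tprod_wallis hq.1 hq.2).symm

theorem tendsto_qGuilleraValue :
    Tendsto (fun q : ℝ => qGuilleraValue q / (1 - (q : ℂ)) ^ 2) (𝓝[<] 1)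
      (𝓝 (1 / 12 * (48 / (Real.pi : ℂ) ^ 2))) := by
  have h2 : ∀ᶠ p : ℝ in 𝓝[<] 1, 0 < p ∧ p < 1 := Ioo_mem_nhdsLT (by norm_num)
  have hpi : (Real.pi : ℂ) ≠ 0 := by exact_mod_cast Real.pi_ne_zero
  have h := (((tendsto_ofReal_one.const_add 1).pow 4).div (tendsto_qGamma_half_sq.pow 3)
    (pow_ne_zero 3 hpi)).mul ((Complex.continuous_ofReal.tendsto _).comp tendsto_tsum_altAbs)
  have e : ((1 : ℂ) + 1) ^ 4 / (Real.pi : ℂ) ^ 3 * ((Real.pi / 4 : ℝ) : ℂ) =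
      1 / 12 * (48 / (Real.pi : ℂ) ^ 2) := by
    push_cast
    field_simp
    norm_num
  rw [e] at h
  refine h.congr' ?_
  filter_upwards [h2] with q hq
  have hD := ofReal_one_sub_ne_zero hq.2
  simp only [Function.comp, Pi.div_apply]
  rw [qGuilleraValue, ← tsum_altTerm_ofReal hq.1 hq.2,
    show qGamma (q ^ 2) (1 / 2) ^ 6 = (qGamma (q ^ 2) (1 / 2) ^ 2) ^ 3 by ring,
    show 1 - (q : ℂ) ^ 2 = (1 - q) * (1 + q) by ring]
  generalize qGamma (q ^ 2) (1 / 2) ^ 2 = G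
  generalize 1 - (q : ℂ) = D at *
  field_simp

/-! ### Nonvanishing of the boundary value -/

namespace QParam

variable {q : ℝ} {a s x : ℂ}

theorem wzConst_ne_zero (h : QParam q a s x) : wzConst s x ≠ 0 := by
  have hw := h.wzParam
  have i1 : qPochInf (x * s) (s ^ 2) ≠ 0 := qPochInf_ne_zero hw.sq_lt fun i => by
    rw [h.sq_s]
    exact_mod_cast h.one_sub_half_ne i
  have i2 := qPochInf_ne_zero hw.sq_lt hw.x_ne
  have i3 := qPochInf_ne_zero hw.sq_lt hw.sq_ne
  have i4 := qPochInf_ne_zero hw.sq_lt hw.cube_ne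
  unfold wzConst
  positivity

theorem boundaryValue_ne_zero (h : QParam q a s x) : boundaryValue q a ≠ 0 := by
  have hx : 1 - x ≠ 0 := by simpa using h.one_sub_x_ne 0
  have hw := h.wzParam
  have hs1 : 1 - s ≠ 0 := one_sub_ne_zero_of_norm_lt_one h.norm_s_lt
  have hs2 : 1 + s ≠ 0 := by
    simpa using one_sub_ne_zero_of_norm_lt_one (z := -s) (by simpa using h.norm_s_lt)
  have hQ := qPochInf_ne_zero hw.sq_lt (one_sub_mul_pow_ne_zero hw.sq_lt hw.sq_lt)
  have hT : ∑' r, altTerm s r ≠ 0 := by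
    -- The sign argument for the alternating series is real, so `s` is identified with the real
    -- square root of `q`.
    have e : s = ((q ^ (1 / 2 : ℝ) : ℝ) : ℂ) := by
      rw [h.s_eq, Complex.ofReal_cpow h.q_pos.le]
      norm_num
    rw [e]
    exact tsum_altTerm_ne_zero (Real.rpow_pos_of_pos h.q_pos _)
      (Real.rpow_lt_one h.q_pos.le h.q_lt (by norm_num))
  rw [h.boundaryValue_eq, tsum_pow_div_qPoch h.norm_s_lt]
  exact mul_ne_zero h.factorA_ne_zero (div_ne_zero (mul_ne_zero h.wzConst_ne_zero
    (mul_ne_zero (div_ne_zero hs2 (mul_ne_zero hs1 hQ)) hT)) (pow_ne_zero 3 hx))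

end QParam

/-! ### The main theorem -/

theorem mainTheorem5 :
    -- the `q`-series identity
    (∀ q : ℝ, 0 < q → q < 1 →
      Summable (fun k : ℕ => altTerm q k) ∧
      HasSum (fun n : ℕ => qGuilleraTerm q n) (qGuilleraValue q)) ∧
    -- it is a `q`-analogue of Guillera's formula
    (∀ n : ℕ, Tendsto (fun q : ℝ => qGuilleraTerm q n / (1 - (q : ℂ)) ^ 2) (𝓝[<] 1)
      (𝓝 (1 / 12 * guilleraTerm n))) ∧
    Tendsto (fun q : ℝ => qGuilleraValue q / (1 - (q : ℂ)) ^ 2) (𝓝[<] 1)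
      (𝓝 (1 / 12 * (48 / (Real.pi : ℂ) ^ 2))) ∧
    -- the boundary limit and the identity with the parameter `a`
    (∀ (q : ℝ) (a : ℂ), 0 < q → q < 1 →
      (∀ m : ℤ, (q : ℂ) ^ (2 * a) ≠ (q : ℂ) ^ m ∧ (q : ℂ) ^ (3 * a) ≠ (q : ℂ) ^ m) →
      (∀ n : ℕ, Summable (fun k : ℕ => wzF q (n + a) k)) ∧
      Summable (fun k : ℕ => altTerm ((q : ℂ) ^ (1 / 2 : ℂ)) k) ∧
      Tendsto (fun n : ℕ => ∑' k : ℕ, wzF q (n + a) k) atTop (𝓝 (boundaryValue q a)) ∧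
      boundaryValue q a ≠ 0 ∧
      factorA q a ≠ 0 ∧
      Summable (fun k : ℕ => kTerm q a k) ∧
      Summable (fun n : ℕ => nTerm q a n) ∧
      (∑' k : ℕ, kTerm q a k) =
        (∑' n : ℕ, nTerm q a n) + 1 / factorA q a * boundaryValue q a) := by
  refine ⟨fun q h0 h1 => ⟨summable_altTerm (norm_ofReal_lt_one h0 h1), hasSum_qGuilleraTerm h0 h1⟩,
    tendsto_qGuilleraTerm, tendsto_qGuilleraValue, fun q a h0 h1 hne => ?_⟩
  have h : QParam q a ((q : ℂ) ^ (1 / 2 : ℂ)) ((q : ℂ) ^ a) := ⟨h0, h1, hne, rfl, rfl⟩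
  have hw := h.wzParam
  have hA := h.factorA_ne_zero
  simp_rw [h.wzF_eq, h.kTerm_eq, h.nTerm_eq]
  -- Division by `(1 - x)^3` undoes the normalisation of the WZ pair; the hypotheses on `a` make it
  -- nonzero.
  have hG := hw.hasSum_G0.div_const ((1 - (q : ℂ) ^ a) ^ 3)
  refine ⟨fun n => ((hw.summable_phi n).div_const _).mul_left _, summable_altTerm h.norm_s_lt, ?_,
    h.boundaryValue_ne_zero, hA, (hw.summable_phi 0).div_const _, hG.summable, ?_⟩
  · rw [h.boundaryValue_eq]
    simp_rw [tsum_mul_left, tsum_div_const]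
    exact (hw.tendsto_tsum_phi.div_const _).const_mul _
  · rw [hG.tsum_eq, tsum_div_const, h.boundaryValue_eq]
    field_simp
    ring

end
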